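/- Let $L_\varepsilon, L_0, L_\infty$ ($\varepsilon\in\{+,-\}$) be a Kauffman skein triple of link diagrams in the plane: the three diagrams coincide outside a disc, and inside the disc $L_\varepsilon$ has a single crossing $p$, while $L_0$ and $L_\infty$ are its two crossingless smoothings. Let $L_\varepsilon$ be given any orientation, let $\varepsilon$ be the sign of $p$ for it ($+$ for a right-handed crossing), let $L_0$ be the smoothing of $p$ that respects this orientation, with the orientation induced from $L_\varepsilon$, and let $L_\infty$ be the other smoothing, with an arbitrary orientation. For an oriented diagram $L$ let $w(L)$ be its writhe (the sum of the signs of its crossings). Colour the regions of the complement in checkerboard fashion with the unbounded region $X_0$ white, and let $X_0,\dots,X_n$ be the white regions. For a crossing $q$ put $\eta(q)=1$ if the upper strand, rotated counterclockwise onto the lower strand, sweeps the black corners at $q$, and $\eta(q)=-1$ otherwise; call $q$ of type II if its black corners are the two corners lying between two outgoing, respectively two incoming, strands. The Goeritz matrix $G(L)=(g_{ij})_{i,j=1}^n$ has $g_{ij}=-\sum\eta(q)$ over the crossings $q$ connecting $X_i$ and $X_j$ for $i\ne j$ ($0\le i,j\le n$), and $g_{ii}=-\sum_{k\neq i,\,0\le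 k\le n} g_{ik}$. The signature of $L$ is $\sigma(L)=\sigma(G(L))-\sum_{q\text{ of type II}}\eta(q)$, and its determinant is $Det_L=\det(iH(L))$, where $H(L)$ is the block sum of $G(L)$, the diagonal matrix with entries $-\eta(q)$ over the crossings $q$ of type II, and the zero matrix of size $\beta(L)-1$; here $\beta(L)$ is the number of connected components of the graph whose vertices are the black regions and whose edges are the crossings. Assume $Det_{L_0}\neq 0$ and $Det_{L_\infty}\ne 0$. 1. If $\varepsilon=+$, then $|Det_{L_+}|=|Det_{L_0}|+|Det_{L_\infty}|$ if and only if $$\sigma(L_+)=\sigma(L_0)-1\quad\text{and}\quad \sigma(L_+)=\sigma(L_\infty)-\tfrac12\bigl(w(L_0)-w(L_\infty)\bigr).$$ 2. If $\varepsilon=-$, then $|Det_{L_-}|=|Det_{L_0}|+|Det_{L_\infty}|$ if and only if $$\sigma(L_-)=\sigma(L_0)+1\quad\text{and}\quad \sigma(L_-)=\sigma(L_\infty)-\tfrac12\bigl(w(L_0)-w(L_\infty)\bigr).$$ -/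

import Mathlib

/-! Link diagrams in the plane, up to planar isotopy.

A diagram is presented by a connected plane graph all of whose vertices have degree four, together
with the tangle that is put into a small disc around each vertex: either a crossing or one of the two
crossingless ways to join the four ends. Every link diagram arises, including split
diagrams and components without crossings: the pieces of a split diagram (or a round circle)
are connected through discs that hold a crossingless tangle. -/

noncomputable section

/-- The four half-edges at a vertex `v` are `(v, 0), (v, 1), (v, 2), (v, 3)`, numbered
counterclockwise around `v`. The same pair `(v, i)` also names the corner (sector) at `v` between the
half-edges `(v, i)` and `(v, i + 1)`. -/
abbrev Dart (V : Type*) := V × ZMod 4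

/-- Counterclockwise rotation by a quarter turn about each vertex. -/
def rot {V : Type*} : Equiv.Perm (Dart V) :=
  (Equiv.refl V).prodCongr (Equiv.addRight (1 : ZMod 4))

/-- If `edge` matches the half-edges into edges, the corner on the left of a half-edge `d`, walking
away from its vertex, continues along that edge to the corner just before `edge d`. The cycles of this
permutation of the corners are the faces. -/
def facePerm {V : Type*} (edge : Equiv.Perm (Dart V)) : Equiv.Perm (Dart V) :=
  rot⁻¹ * edge

/-- A connected graph embedded in the plane, all of whose vertices have degree four
(loops and multiple edges are allowed), as a rotation system of genus zero with a
chosen unbounded face. -/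
structure PlaneGraph (V : Type*) [Fintype V] where
  /-- The other half of an edge. -/
  edge : Equiv.Perm (Dart V)
  edge_edge : ∀ d, edge (edge d) = d
  edge_ne : ∀ d, edge d ≠ d
  connected : ∀ d d', Relation.EqvGen (fun x y => y = rot x ∨ y = edge x) d d'
  /-- Vertices minus edges plus faces is two; there are twice as many edges as vertices. -/
  euler : (Fintype.card V : ℤ) - 2 * Fintype.card V
    + Nat.card (Quotient (Equiv.Perm.SameCycle.setoid (facePerm edge))) = 2
  /-- A corner of the unbounded face. -/
  unbounded : Dart V

/-- The parity of the number of a half-edge or corner. -/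
def parity : ZMod 4 →+* ZMod 2 := ZMod.castHom (by decide) (ZMod 2)

/-- What is drawn in the disc around a vertex. -/
inductive Filling
  /-- A crossing; the upper strand runs through the two half-edges of parity `a`, the lower strand
  through the other two. -/
  | crossing (a : ZMod 2)
  /-- Two disjoint arcs, drawn so that the two opposite corners of parity `a` become connected to
  each other; each arc cuts off one of the two corners of the other parity, that is, it joins the
  two half-edges that bound such a corner. -/
  | smoothing (a : ZMod 2)

variable {V : Type*} [Fintype V]

namespace PlaneGraph

variable (P : PlaneGraph V)

/-- `P.PathParity b c`: some path from the unbounded face to the corner `c` crosses the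
edges a number of times congruent to `b` modulo two. -/
inductive PathParity : ZMod 2 → Dart V → Prop
  | start : PathParity 0 P.unbounded
  | face {b : ZMod 2} {c : Dart V} : PathParity b c → PathParity b (facePerm P.edge c)
  | cross {b : ZMod 2} {c : Dart V} : PathParity b c → PathParity (b + 1) (rot c)

/-- The checkerboard colouring in which the unbounded face is white: white corners. -/
def White (c : Dart V) : Prop := P.PathParity 0 c

/-- The checkerboard colouring in which the unbounded face is white: black corners. -/
def Black (c : Dart V) : Prop := P.PathParity 1 c

end PlaneGraph

/-- An unoriented link diagram in the plane. -/
structure Diagram (P : PlaneGraph V) where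
  filling : V → Filling

namespace Diagram

variable {P : PlaneGraph V} (D : Diagram P)

/-- Two corners that lie in the same region of the complement of the diagram for one of the two
elementary reasons: they are consecutive along a face of the graph, or they are opposite at
a vertex where the diagram connects them. -/
def Joined (c c' : Dart V) : Prop :=
  c' = facePerm P.edge c ∨
    ∃ (v : V) (i : ZMod 4), c = (v, i) ∧ c' = (v, i + 2) ∧ D.filling v = .smoothing (parity i)

/-- The regions into which the diagram divides the plane. -/
def Region : Type _ := Quot D.Joined

/-- The region in which a corner lies. -/
def region (c : Dart V) : D.Region := Quot.mk _ c

instance : Finite D.Region := inferInstanceAs (Finite (Quot D.Joined))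

/-- White regions (the two ends of a smoothing have the same colour, so regions are coloured). -/
def WhiteRegion : Type _ := {r : D.Region // ∃ c, P.White c ∧ D.region c = r}

/-- Black regions. -/
def BlackRegion : Type _ := {r : D.Region // ∃ c, P.Black c ∧ D.region c = r}

instance : Fintype D.WhiteRegion :=
  @Fintype.ofFinite _ (inferInstanceAs (Finite {r : D.Region // ∃ c, P.White c ∧ D.region c = r}))

/-- The vertices that are crossings of the diagram. -/
def IsCrossing (v : V) : Prop := ∃ a, D.filling v = .crossing a

open scoped Classical in
/-- The incidence number `η` of a crossing: it is `1` if the upper strand sweeps the black corners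
when it is rotated counterclockwise onto the lower one, and `-1` if it sweeps the white corners. -/
def eta (v : V) : ℤ :=
  match D.filling v with
  | .crossing a => if ∃ i, parity i = a ∧ P.Black (v, i) then 1 else -1
  | .smoothing _ => 0

/-- The crossing `v` connects the white regions `r` and `s`. -/
def Connects (v : V) (r s : D.WhiteRegion) : Prop :=
  D.IsCrossing v ∧ ∃ i, P.White (v, i) ∧ D.region (v, i) = r.1 ∧ D.region (v, i + 2) = s.1

open scoped Classical in
/-- Minus the sum of `η` over the crossings that connect `r` and `s`. -/
def goeritzEntry (r s : D.WhiteRegion) : ℤ := -∑ v with D.Connects v r s, D.eta v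

open scoped Classical in
/-- The unreduced Goeritz matrix. -/
def unreducedGoeritz : Matrix D.WhiteRegion D.WhiteRegion ℤ :=
  Matrix.of fun r s =>
    if r = s then -∑ k with k ≠ r, D.goeritzEntry r k else D.goeritzEntry r s

/-- The white regions other than the unbounded one. -/
def BoundedWhiteRegion : Type _ := {r : D.WhiteRegion // r.1 ≠ D.region P.unbounded}

open scoped Classical in
instance : Fintype D.BoundedWhiteRegion :=
  inferInstanceAs (Fintype {r : D.WhiteRegion // r.1 ≠ D.region P.unbounded})

/-- The Goeritz matrix: the row and column of the unbounded region are removed. -/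
def goeritz : Matrix D.BoundedWhiteRegion D.BoundedWhiteRegion ℤ :=
  D.unreducedGoeritz.submatrix Subtype.val Subtype.val

/-- The number `β` of connected components of the Tait graph, whose vertices are the black regions
and whose edges are the crossings. -/
def taitComponents : ℕ :=
  Nat.card (Quot fun r s : D.BlackRegion =>
    ∃ (v : V) (i : ZMod 4), D.IsCrossing v ∧ P.Black (v, i) ∧
      D.region (v, i) = r.1 ∧ D.region (v, i + 2) = s.1)

end Diagram

/-- An oriented link diagram; `out d` says that the strand through the half-edge `d` is
directed away from the vertex. -/
structure OrientedDiagram (P : PlaneGraph V) extends Diagram P where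
  out : Dart V → Bool
  out_edge : ∀ d, out (P.edge d) = !out d
  /-- A strand that enters a crossing leaves it through the opposite half-edge. -/
  out_crossing : ∀ v a i, filling v = .crossing a → out (v, i + 2) = !out (v, i)
  /-- An arc of a smoothing enters through one of its half-edges and leaves through the other. -/
  out_smoothing : ∀ v a i, filling v = .smoothing a → parity i ≠ a → out (v, i + 1) = !out (v, i)

open scoped Classical in
/-- The signature of a symmetric integral matrix, as a real quadratic form. -/
def matrixSignature {n : Type*} [Fintype n] (M : Matrix n n ℤ) : ℤ :=
  (sigPos (M.map (Int.cast : ℤ → ℝ)).toQuadraticForm' : ℤ)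
    - sigNeg (M.map (Int.cast : ℤ → ℝ)).toQuadraticForm'

namespace OrientedDiagram

variable {P : PlaneGraph V} (L : OrientedDiagram P)

open scoped Classical in
/-- The sign of a crossing: positive when a counterclockwise quarter turn takes the outgoing
half of the upper strand to the outgoing half of the lower strand (right-handed crossing). -/
def sign (v : V) : ℤ :=
  match L.filling v with
  | .crossing a =>
    if ∃ i, parity i = a ∧ L.out (v, i) = true ∧ L.out (v, i + 1) = true then 1 else -1
  | .smoothing _ => 0

/-- The writhe (sum of the signs of the crossings). -/
def writhe : ℤ := ∑ v, L.sign v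

/-- A crossing is of type II if its black corners are the ones between two outgoing and
between two incoming half-edges, so that the two black corners do not carry
compatible boundary orientations. -/
def TypeII (v : V) : Prop :=
  L.IsCrossing v ∧ ∃ i, P.Black (v, i) ∧ L.out (v, i) = L.out (v, i + 1)

open scoped Classical in
/-- The correction term `μ`: the sum of `η` over the crossings of type II. -/
def mu : ℤ := ∑ v with L.TypeII v, L.eta v

/-- The signature of an oriented link, computed from a diagram. -/
def signature : ℤ := matrixSignature L.goeritz - L.mu

open scoped Classical in
/-- The generalized Goeritz matrix: the block sum of the Goeritz matrix, the diagonal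
matrix with entries `-η` over the crossings of type II, and a zero matrix of size `β - 1`. -/
def generalizedGoeritz :
    Matrix (L.BoundedWhiteRegion ⊕ ({v : V // L.TypeII v} ⊕ Fin (L.taitComponents - 1)))
      (L.BoundedWhiteRegion ⊕ ({v : V // L.TypeII v} ⊕ Fin (L.taitComponents - 1))) ℤ :=
  Matrix.fromBlocks L.goeritz 0 0
    (Matrix.fromBlocks (Matrix.diagonal fun v => -L.eta v.1) 0 0 0)

open scoped Classical in
/-- The determinant of an oriented link, computed from a diagram. -/
def Det : ℂ := (Complex.I • L.generalizedGoeritz.map (Int.cast : ℤ → ℂ)).det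

end OrientedDiagram

/-- A Kauffman skein triple: three diagrams that coincide outside a disc around `p`. In the disc `L`
has a crossing and `L₀`, `Linf` have the two smoothings of it; `L₀` carries the
orientation of `L` (so it is the smoothing that respects this orientation), and `Linf` carries any
orientation whatsoever. -/
structure IsSkeinTriple {P : PlaneGraph V} (p : V) (L L₀ Linf : OrientedDiagram P) : Prop where
  crossing : L.IsCrossing p
  smoothings : ∃ a, L₀.filling p = .smoothing a ∧ Linf.filling p = .smoothing (a + 1)
  outside_zero : ∀ v, v ≠ p → L₀.filling v = L.filling v
  outside_inf : ∀ v, v ≠ p → Linf.filling v = L.filling v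
  orientation : L₀.out = L.out

end

/-! Let `B` be the matrix of incidences (0 or ±1) of crossings with bounded white regions. Then the
Goeritz matrix is `Bᵀ diag(η) B`. Write `v` for the row of `B` at `p`. Smoothing `p` so that its
black corners merge changes no white region and sets the weight of `p` to zero, so the Goeritz form
becomes `A = G - η(p) v vᵀ`. Smoothing `p` so that its white corners merge restricts the form to the
functions equal on the two merged regions, that is, to the kernel of `v`, where `G` and `A` agree;
call the restriction `C`.

If `v ≠ 0`, the kernel of `v` is a hyperplane. With `d` the Schur complement of `C` in `A`, one has
`det A = d det C` and `det G = (d + η) det C`, while the signatures of `A` and `G` exceed that of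
`C` by the signs of `d` and `d + η`. The determinants add up in absolute value iff `|d + η| = |d| +
1`, that is, iff `d + η` has the sign of `d` and of `η` (`abs_det_rankOne_update_iff`,
`Diagram.abs_det_goeritz_iff`). If `v = 0`, all three forms coincide and both sides of the
equivalence fail.

The absolute value of the link determinant is `|det G|` when the Tait graph has at most one
component and zero otherwise (`OrientedDiagram.norm_det`). The black smoothing contracts an edge of
that graph, so connectedness passes from it to `L`. It remains to compare correction terms: the
orientation-preserving smoothing is the black one exactly when `p` is of type II, the sign of `p` is
`η` for type II and `-η` otherwise, and half the difference of the writhes of the two smoothings is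
the difference of their `μ`. -/

/-! ### Signatures and determinants of real quadratic forms -/

open scoped Classical in
-- Turns the signature of a diagonal form into a sum over its weights, so that one further weight
-- contributes one further summand.
theorem sub_ncard_eq_sum_sign {ι : Type*} [Fintype ι] (w : ι → ℝ) :
    (({i | 0 < w i}.ncard : ℤ) - ({i | w i < 0}.ncard : ℤ)) = ∑ i, (SignType.sign (w i) : ℤ) := by
  rw [Set.ncard_eq_toFinset_card', Set.ncard_eq_toFinset_card', Finset.card_eq_sum_ones,
    Finset.card_eq_sum_ones]
  simp only [Set.toFinset_ofPred, Finset.sum_filter, Nat.cast_sum, ← Finset.sum_sub_distrib]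
  refine Finset.sum_congr rfl fun i _ => ?_
  rcases lt_trichotomy (w i) 0 with h | h | h
  · simp [h, h.not_gt]
  · simp [h]
  · simp [h, h.not_gt]

/-- Adding an orthogonal line of square `d` to a quadratic form changes its signature by the
sign of `d`. -/
theorem signature_of_split {M N : Type*} [AddCommGroup M] [Module ℝ M] [FiniteDimensional ℝ M]
    [AddCommGroup N] [Module ℝ N] (Q : QuadraticForm ℝ M) (Q' : QuadraticForm ℝ N) (d : ℝ)
    (e : N ≃ₗ[ℝ] M × ℝ) (h : ∀ x, Q' x = Q (e x).1 + d * ((e x).2 * (e x).2)) :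
    (sigPos Q' : ℤ) - sigNeg Q' = (sigPos Q - sigNeg Q) + SignType.sign d := by
  have : Invertible (2 : ℝ) := invertibleOfNonzero (NeZero.ne _)
  obtain ⟨w, ⟨f⟩⟩ := Q.equivalent_weightedSumSquares
  have h1 : Q'.Equivalent (QuadraticMap.weightedSumSquares ℝ
      (Sum.elim w (fun _ : Unit => d))) := by
    refine ⟨⟨e.trans ((f.toLinearEquiv.prodCongr (LinearEquiv.funUnique Unit ℝ ℝ).symm).trans
      (LinearEquiv.sumArrowLequivProdArrow _ _ ℝ ℝ).symm), fun x => ?_⟩⟩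
    have hf := f.map_app (e x).1
    rw [h, ← hf]
    simp only [QuadraticMap.weightedSumSquares_apply]
    simp
  rw [QuadraticForm.sigPos_of_equiv_weightedSumSquares h1,
    QuadraticForm.sigNeg_of_equiv_weightedSumSquares h1,
    QuadraticForm.sigPos_of_equiv_weightedSumSquares ⟨f⟩,
    QuadraticForm.sigNeg_of_equiv_weightedSumSquares ⟨f⟩, sub_ncard_eq_sum_sign,
    sub_ncard_eq_sum_sign]
  simp

/-- The signature of a real matrix, as a quadratic form. -/
noncomputable def realSignature {n : Type*} [Fintype n] [DecidableEq n] (M : Matrix n n ℝ) : ℤ :=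
  (sigPos M.toQuadraticForm' : ℤ) - sigNeg M.toQuadraticForm'

/-- Replaces the classical decidability instance inside `matrixSignature` by an arbitrary one. -/
theorem matrixSignature_eq_realSignature {n : Type*} [Fintype n] [DecidableEq n]
    (M : Matrix n n ℤ) : matrixSignature M = realSignature (M.map (Int.cast : ℤ → ℝ)) := by
  unfold matrixSignature realSignature
  congr!

open Matrix

section
variable {m n : Type*} [Fintype m] [DecidableEq m] [Fintype n] [DecidableEq n]

theorem toQuadraticForm'_eq_dotProduct (M : Matrix n n ℝ) (x : n → ℝ) :
    M.toQuadraticForm' x = x ⬝ᵥ (M *ᵥ x) := by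
  simp [Matrix.toQuadraticForm', toLinearMap₂'_apply']

theorem realSignature_submatrix (M : Matrix n n ℝ) (e : m ≃ n) :
    realSignature (M.submatrix e e) = realSignature M := by
  have h : (M.submatrix e e).toQuadraticForm'.Equivalent M.toQuadraticForm' := by
    refine ⟨⟨LinearEquiv.funCongrLeft ℝ ℝ e.symm, fun x => ?_⟩⟩
    simp only [toQuadraticForm'_eq_dotProduct, dotProduct, mulVec]
    simp [LinearEquiv.funCongrLeft, ← e.sum_comp]
  unfold realSignature
  rw [h.sigPos_eq, h.sigNeg_eq]

theorem realSignature_congruent (M U : Matrix n n ℝ) (hU : IsUnit U.det) :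
    realSignature (Uᵀ * M * U) = realSignature M := by
  have h : (Uᵀ * M * U).toQuadraticForm'.Equivalent M.toQuadraticForm' := by
    refine ⟨⟨LinearEquiv.ofBijective (Matrix.toLin' U)
      ⟨Matrix.mulVec_injective_iff_isUnit.2 ((Matrix.isUnit_iff_isUnit_det U).2 hU),
        Matrix.mulVec_surjective_iff_isUnit.2 ((Matrix.isUnit_iff_isUnit_det U).2 hU)⟩, fun x => ?_⟩⟩
    simp only [toQuadraticForm'_eq_dotProduct]
    change (U *ᵥ x) ⬝ᵥ (M *ᵥ (U *ᵥ x)) = _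
    simp [← Matrix.mulVec_mulVec, Matrix.dotProduct_mulVec, Matrix.vecMul_transpose]
  unfold realSignature
  rw [h.sigPos_eq, h.sigNeg_eq]

theorem realSignature_fromBlocks_diagonal (C : Matrix m m ℝ) (d : ℝ) :
    realSignature (fromBlocks C 0 0 (Matrix.diagonal fun _ : Unit => d)) =
      realSignature C + SignType.sign d := by
  refine signature_of_split _ _ d ((LinearEquiv.sumArrowLequivProdArrow _ _ ℝ ℝ).trans
    ((LinearEquiv.refl ℝ _).prodCongr (LinearEquiv.funUnique Unit ℝ ℝ))) fun x => ?_
  simp only [toQuadraticForm'_eq_dotProduct, fromBlocks_mulVec]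
  simp [dotProduct, Matrix.mulVec, LinearEquiv.sumArrowLequivProdArrow,
    Equiv.sumArrowEquivProdArrow]
  ring

/-- A symmetric matrix with an invertible principal block of corank one is congruent to the sum of
that block and the Schur complement. -/
theorem realSignature_fromBlocks (C : Matrix m m ℝ) (b : Matrix m Unit ℝ) (c : Matrix Unit Unit ℝ)
    (hC : C.IsSymm) (hdet : C.det ≠ 0) :
    realSignature (fromBlocks C b bᵀ c) =
      realSignature C + SignType.sign ((c - bᵀ * C⁻¹ * b) () ()) := by
  have hu : IsUnit C.det := isUnit_iff_ne_zero.2 hdet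
  -- Completing the square: the unipotent matrix with off-diagonal block `C⁻¹ * b` carries the block
  -- sum of `C` and the Schur complement to the given matrix.
  rw [← realSignature_fromBlocks_diagonal,
    ← realSignature_congruent (fromBlocks C 0 0 _) (fromBlocks 1 (C⁻¹ * b) 0 1) (by simp)]
  congr 1
  have hd : (Matrix.diagonal fun _ : Unit => (c - bᵀ * C⁻¹ * b) () ()) = c - bᵀ * C⁻¹ * b := by
    ext; simp
  have hCt : (C⁻¹)ᵀ = C⁻¹ := by rw [Matrix.transpose_nonsing_inv, hC.eq]
  rw [hd]
  simp [fromBlocks_transpose, fromBlocks_multiply, hCt, Matrix.mul_assoc,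
    Matrix.nonsing_inv_mul C hu, ← Matrix.mul_assoc C, Matrix.mul_nonsing_inv C hu]

theorem det_fromBlocks_unit (C : Matrix m m ℝ) (b : Matrix m Unit ℝ) (b' : Matrix Unit m ℝ)
    (c : Matrix Unit Unit ℝ) (hdet : C.det ≠ 0) :
    (fromBlocks C b b' c).det = C.det * (c - b' * C⁻¹ * b) () () := by
  have : Invertible C := C.invertibleOfIsUnitDet (isUnit_iff_ne_zero.2 hdet)
  rw [det_fromBlocks₁₁, det_unique (c - _), invOf_eq_nonsing_inv]

/-- Equality in the triangle inequality means that `d` and `η` have equal signs. The condition is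
phrased through `d + η` because the signs of `d` and `d + η` are what the signatures record. -/
theorem abs_add_eq_iff_sign (d η : ℝ) (hd : d ≠ 0) (hη : η = 1 ∨ η = -1) :
    |d + η| = |d| + 1 ↔
      SignType.sign (d + η) = SignType.sign d ∧ SignType.sign (d + η) = SignType.sign η := by
  rcases hη with rfl | rfl
  · constructor
    · intro h
      have hd' : 0 < d := by
        by_contra hc
        have := lt_of_le_of_ne (not_lt.1 hc) hd
        rw [abs_of_neg this] at h
        rcases abs_cases (d + 1) with ⟨h1, _⟩ | ⟨h1, _⟩ <;> linarith
      simp [hd', add_pos hd' one_pos]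
    · rintro ⟨h1, h2⟩
      rw [h2, sign_one] at h1
      have := sign_eq_one_iff.1 h1.symm
      rw [abs_of_pos this, abs_of_pos (add_pos this one_pos)]
  · constructor
    · intro h
      have hd' : d < 0 := by
        by_contra hc
        have := lt_of_le_of_ne (not_lt.1 hc) hd.symm
        rw [abs_of_pos this] at h
        rcases abs_cases (d + -1) with ⟨h1, _⟩ | ⟨h1, _⟩ <;> linarith
      have : d + -1 < 0 := by linarith
      rw [sign_neg hd', sign_neg this, sign_neg (by norm_num)]
      simp
    · rintro ⟨h1, h2⟩
      rw [h2, sign_neg (by norm_num : (-1 : ℝ) < 0)] at h1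
      have := sign_eq_neg_one_iff.1 h1.symm
      rw [abs_of_neg this, abs_of_neg (by linarith)]
      ring

/-- Adding `±v vᵀ` to a nondegenerate form `A`, compared with the restriction of `A` to a complement
of a vector on which `v` is `±1`. -/
theorem abs_det_rankOne_update_iff (A : Matrix (m ⊕ Unit) (m ⊕ Unit) ℝ) (hA : A.IsSymm)
    (T : Matrix (m ⊕ Unit) m ℝ) (hT : T.toRows₁ = 1) (C : Matrix m m ℝ) (hC : C = Tᵀ * A * T)
    (v : m ⊕ Unit → ℝ) (η : ℝ) (hη : η = 1 ∨ η = -1)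
    (hv : v (Sum.inr ()) * v (Sum.inr ()) = 1) (hvw : v ᵥ* T = 0)
    (hdA : A.det ≠ 0) (hdC : C.det ≠ 0) :
    |(A + η • vecMulVec v v).det| = |A.det| + |C.det| ↔
      realSignature (A + η • vecMulVec v v) = realSignature A ∧
      realSignature (A + η • vecMulVec v v) = realSignature C + SignType.sign η := by
  -- The basis consists of the columns of `T` and the last coordinate vector; it is unipotent
  -- because the top block of `T` is the identity. In it `v` vanishes on all vectors but the last,
  -- where it is ±1, so the update only adds `η` to the corner entry.
  let E : Matrix (m ⊕ Unit) Unit ℝ := fromRows 0 1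
  let U : Matrix (m ⊕ Unit) (m ⊕ Unit) ℝ := fromCols T E
  have hUdet : U.det = 1 := by
    have : U = fromBlocks 1 0 T.toRows₂ 1 := by
      rw [← hT]
      ext (i | i) (j | j) <;> simp [U, E, toRows₁, toRows₂]
    rw [this]; simp
  have hUA : ∀ B : Matrix (m ⊕ Unit) (m ⊕ Unit) ℝ, Uᵀ * B * U =
      fromBlocks (Tᵀ * B * T) (Tᵀ * B * E)
        (Eᵀ * B * T) (Eᵀ * B * E) := fun B => by
    rw [← fromRows_fromCols_eq_fromBlocks]
    simp only [U, transpose_fromCols, fromRows_mul, mul_fromCols, fromCols_fromRows_eq_fromBlocks,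
      fromRows_fromCols_eq_fromBlocks]
  have hCs : C.IsSymm := by
    simp only [IsSymm, hC, transpose_mul, transpose_transpose, hA.eq, Matrix.mul_assoc]
  have hb : Eᵀ * A * T = (Tᵀ * A * E)ᵀ := by
    simp only [transpose_mul, transpose_transpose, hA.eq, Matrix.mul_assoc]
  have hvE : v ᵥ* E = fun _ => v (Sum.inr ()) := by
    ext; simp [E, vecMul, dotProduct]
  have hBA : Uᵀ * A * U = fromBlocks C (Tᵀ * A * E) (Tᵀ * A * E)ᵀ
      (Eᵀ * A * E) := by rw [hUA, hb, ← hC]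
  have hBA' : Uᵀ * (A + η • vecMulVec v v) * U = fromBlocks C (Tᵀ * A * E)
      (Tᵀ * A * E)ᵀ (Eᵀ * A * E + η • 1) := by
    have h1 : Tᵀ * (η • vecMulVec v v) = 0 := by
      rw [Matrix.mul_smul, mul_vecMulVec, mulVec_transpose, hvw]; simp
    have h2 : (η • vecMulVec v v) * T = 0 := by
      rw [Matrix.smul_mul, vecMulVec_mul, hvw]; ext; simp [vecMulVec_apply]
    have h3 : Eᵀ * (η • vecMulVec v v) * E = η • 1 := by
      rw [Matrix.mul_smul, mul_vecMulVec, mulVec_transpose, Matrix.smul_mul, vecMulVec_mul, hvE]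
      ext; simp [vecMulVec_apply, hv]
    rw [hUA]
    simp only [Matrix.mul_add, Matrix.add_mul, h1, h3, Matrix.mul_assoc _ _ T, h2]
    simp [hC, Matrix.mul_assoc, hA.eq]
  have hdet : ∀ B : Matrix (m ⊕ Unit) (m ⊕ Unit) ℝ, B.det = (Uᵀ * B * U).det := fun B => by
    simp [det_mul, hUdet]
  have hsig : ∀ B : Matrix (m ⊕ Unit) (m ⊕ Unit) ℝ,
      realSignature B = realSignature (Uᵀ * B * U) := fun B =>
    (realSignature_congruent B U (by simp [hUdet])).symm
  set b := Tᵀ * A * E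
  set d := (Eᵀ * A * E - bᵀ * C⁻¹ * b) () () with hd
  have hd' : (Eᵀ * A * E + η • (1 : Matrix Unit Unit ℝ) - bᵀ * C⁻¹ * b) () () = d + η := by
    simp [hd]; ring
  rw [hdet (A + _), hdet A, hsig (A + _), hsig A, hBA, hBA', det_fromBlocks_unit _ _ _ _ hdC,
    det_fromBlocks_unit _ _ _ _ hdC, realSignature_fromBlocks _ _ _ hCs hdC,
    realSignature_fromBlocks _ _ _ hCs hdC, hd', ← hd]
  have hd0 : d ≠ 0 := by
    rw [hdet A, hBA, det_fromBlocks_unit _ _ _ _ hdC, ← hd] at hdA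
    exact right_ne_zero_of_mul hdA
  have hCpos : 0 < |C.det| := abs_pos.2 hdC
  rw [abs_mul, abs_mul, ← mul_add_one, mul_right_inj' hCpos.ne', abs_add_eq_iff_sign d η hd0 hη]
  have hinj : ∀ a b : SignType, (a : ℤ) = b ↔ a = b := by decide
  rw [add_right_inj, add_right_inj, hinj, hinj]

end

/-! ### Checkerboard colouring of a plane graph -/

section Colouring

section
variable {V : Type*}

@[simp] theorem rot_apply (v : V) (i : ZMod 4) : rot (v, i) = (v, i + 1) := rfl

@[simp] theorem rot_symm_apply (v : V) (i : ZMod 4) : 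
    (rot.symm : Equiv.Perm (Dart V)) (v, i) = (v, i - 1) := by
  rw [Equiv.symm_apply_eq]; simp

theorem facePerm_apply (edge : Equiv.Perm (Dart V)) (d : Dart V) :
    facePerm edge d = rot.symm (edge d) := rfl

theorem rot_facePerm (edge : Equiv.Perm (Dart V)) (d : Dart V) :
    rot (facePerm edge d) = edge d := by simp [facePerm_apply]

end

variable {V : Type*} [Fintype V]

namespace PlaneGraph
variable (P : PlaneGraph V)

theorem eq_of_invariant {α : Type*} (f : Dart V → α) (hr : ∀ d, f (rot d) = f d)
    (he : ∀ d, f (P.edge d) = f d) (d d' : Dart V) : f d = f d' := by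
  induction P.connected d d' with
  | rel x y h => rcases h with rfl | rfl <;> simp [hr, he]
  | refl => rfl
  | symm _ _ _ ih => exact ih.symm
  | trans _ _ _ _ _ ih1 ih2 => exact ih1.trans ih2

/-- The faces of the graph. -/
abbrev Face := Quotient (Equiv.Perm.SameCycle.setoid (facePerm P.edge))

/-- The face in which a corner lies. -/
def face (d : Dart V) : P.Face := Quotient.mk _ d

theorem face_facePerm (d : Dart V) : P.face (facePerm P.edge d) = P.face d :=
  Quotient.sound (Equiv.Perm.sameCycle_apply_left.2 (Equiv.Perm.SameCycle.refl _ _))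

/-- The corner `d` lies to the right of the half-edge `rot d`, hence to the left of the other half
of that edge. -/
theorem face_rot (d : Dart V) : P.face d = P.face (P.edge (rot d)) := by
  rw [← face_facePerm P (P.edge (rot d)), facePerm_apply, P.edge_edge, Equiv.symm_apply_apply]

theorem face_edge (d : Dart V) : P.face (P.edge d) = P.face (rot.symm d) := by
  rw [face_rot P (rot.symm d), Equiv.apply_symm_apply]

/-- One half of each edge can be selected. -/
theorem exists_edge_section : ∃ S : Set (Dart V), ∀ d, P.edge d ∈ S ↔ d ∉ S := by
  let e := Fintype.equivFin (Dart V)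
  refine ⟨{d | e d < e (P.edge d)}, fun d => ?_⟩
  have : e d ≠ e (P.edge d) := fun h => P.edge_ne d (e.injective h).symm
  simp only [Set.mem_ofPred_eq, P.edge_edge]
  omega

open scoped Classical in
theorem card_edge_section (S : Set (Dart V)) (hS : ∀ d, P.edge d ∈ S ↔ d ∉ S) :
    Fintype.card S = 2 * Fintype.card V := by
  have h1 : Fintype.card S = Fintype.card (Sᶜ : Set (Dart V)) :=
    Fintype.card_congr (P.edge.subtypeEquiv fun d => by simp [hS])
  have h2 : Fintype.card S + Fintype.card (Sᶜ : Set (Dart V)) = 4 * Fintype.card V := by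
    rw [Fintype.card_compl_set, Nat.add_sub_cancel' (Fintype.card_subtype_le _)]
    simp [mul_comm]
  omega

theorem sum_edge_section (S : Set (Dart V)) [DecidablePred (· ∈ S)]
    (hS : ∀ d, P.edge d ∈ S ↔ d ∉ S) {R : Type*}
    [AddCommMonoid R] (k : Dart V → R) :
    ∑ s : S, (k s + k (P.edge s)) = ∑ d, k d := by
  rw [← Fintype.sum_subtype_add_sum_subtype (· ∈ S) k, Finset.sum_add_distrib]
  congr 1
  exact Fintype.sum_equiv (P.edge.subtypeEquiv fun d => by simp [hS]) _ _ fun _ => rfl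

end PlaneGraph

/-- Rank-nullity: a kernel made of constant vectors is at most a line. Connectedness supplies this
hypothesis for incidence matrices. -/
theorem card_le_rank_add_one {K m n : Type*} [Field K] [Fintype m] [Fintype n]
    (M : Matrix m n K) (h : ∀ y : n → K, M.mulVec y = 0 → ∀ a b, y a = y b) :
    Fintype.card n ≤ M.rank + 1 := by
  have h1 := M.mulVecLin.finrank_range_add_finrank_ker
  have h2 : Module.finrank K (LinearMap.ker M.mulVecLin) ≤ 1 := by
    rw [finrank_le_one_iff]
    by_cases hn : ∃ x : LinearMap.ker M.mulVecLin, x ≠ 0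
    · obtain ⟨x, hx⟩ := hn
      refine ⟨x, fun y => ?_⟩
      have : ∃ a, x.1 a ≠ 0 := by
        by_contra hc
        push Not at hc
        exact hx (Subtype.ext (funext hc))
      obtain ⟨a, ha⟩ := this
      refine ⟨y.1 a / x.1 a, Subtype.ext (funext fun b => ?_)⟩
      simp [h x.1 x.2 b a, h y.1 y.2 b a, ha]
    · push Not at hn
      exact ⟨0, fun y => ⟨0, by rw [hn y]; simp⟩⟩
  rw [Module.finrank_fintype_fun_eq_card] at h1
  unfold Matrix.rank
  omega

namespace PlaneGraph
variable (P : PlaneGraph V)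

/-- Two-colourability of the faces of a plane graph all of whose degrees are even. -/
theorem exists_colouring : ∃ f : Dart V → ZMod 2,
    (∀ d, f (facePerm P.edge d) = f d) ∧ ∀ d, f (rot d) = f d + 1 := by
  classical
  obtain ⟨S, hS⟩ := P.exists_edge_section
  have two : ∀ x : ZMod 2, x + x = 0 := by decide
  have eq_of_add : ∀ x y : ZMod 2, x + y = 0 → y = x := by decide
  -- `S` stands for the set of edges. `M` is the incidence matrix of edges and faces, `N` that of
  -- edges and vertices; an edge with the same face, or vertex, on both sides gets the entry `1 + 1
  -- = 0`.
  let M : Matrix S P.Face (ZMod 2) := Matrix.of fun s f =>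
    (if P.face s = f then 1 else 0) + (if P.face (P.edge s) = f then 1 else 0)
  let N : Matrix S V (ZMod 2) := Matrix.of fun s v =>
    (if s.1.1 = v then 1 else 0) + (if (P.edge s).1 = v then 1 else 0)
  have hM : ∀ y s, M.mulVec y s = y (P.face s) + y (P.face (P.edge s)) := fun y s => by
    simp [M, Matrix.mulVec, dotProduct, add_mul, Finset.sum_add_distrib]
  have hN : ∀ y s, N.mulVec y s = y s.1.1 + y (P.edge s).1 := fun y s => by
    simp [N, Matrix.mulVec, dotProduct, add_mul, Finset.sum_add_distrib]
  have onS : ∀ k : Dart V → ZMod 2, (∀ s ∈ S, k s + k (P.edge s) = 0) →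
      ∀ d, k (P.edge d) = k d := fun k hk d => by
    by_cases h : d ∈ S
    · exact eq_of_add _ _ (hk d h)
    · have := hk (P.edge d) ((hS d).2 h)
      rw [P.edge_edge] at this
      exact (eq_of_add _ _ this).symm
  have rM : Fintype.card P.Face ≤ M.rank + 1 := by
    refine card_le_rank_add_one M fun y hy a b => ?_
    have he := onS (fun d => y (P.face d)) fun s hs => by
      rw [← hM y ⟨s, hs⟩, hy]; rfl
    induction a using Quotient.inductionOn with | _ a
    induction b using Quotient.inductionOn with | _ b
    refine P.eq_of_invariant (fun d => y (P.face d)) (fun d => ?_) he a b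
    rw [P.face_rot d]
    exact (he _).symm
  have rN : Fintype.card V ≤ N.rank + 1 := by
    refine card_le_rank_add_one N fun y hy a b => ?_
    have he := onS (fun d => y d.1) fun s hs => by
      rw [← hN y ⟨s, hs⟩, hy]; rfl
    exact P.eq_of_invariant (fun d => y d.1) (fun d => rfl) he (a, 0) (b, 0)
  have hNT : ∀ (h : Dart V → ZMod 2), (∀ d, h (P.edge d) = h d) →
      ∀ v, N.transpose.mulVec (fun s => h s) v = ∑ i, h (v, i) := fun h hh v => by
    have h1 := P.sum_edge_section S hS (fun d => (if d.1 = v then h d else 0))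
    have h2 : ∑ d : Dart V, (if d.1 = v then h d else 0) = ∑ i, h (v, i) := by
      rw [Fintype.sum_prod_type, Finset.sum_eq_single v (fun b _ hb => by simp [hb]) (by simp)]
      simp
    rw [← h2, ← h1]
    simp only [Matrix.mulVec, dotProduct, Matrix.transpose_apply, N, Matrix.of_apply, hh]
    refine Finset.sum_congr rfl fun s _ => ?_
    split_ifs <;> simp [add_mul]
  -- The boundary of a set of faces is a cycle: around a vertex each corner is counted twice.
  have hle : LinearMap.range M.mulVecLin ≤ LinearMap.ker N.transpose.mulVecLin := by
    rintro _ ⟨y, rfl⟩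
    rw [LinearMap.mem_ker, Matrix.mulVecLin_apply, Matrix.mulVecLin_apply]
    ext v
    have : M.mulVec y = fun s : S => (fun d => y (P.face d) + y (P.face (P.edge d))) s :=
      funext fun s => hM y s
    rw [this, hNT (fun d => y (P.face d) + y (P.face (P.edge d)))
      (fun d => by rw [P.edge_edge, add_comm])]
    simp only [face_edge, rot_symm_apply, Finset.sum_add_distrib]
    have hshift := (Equiv.subRight (1 : ZMod 4)).sum_comp (fun i => y (P.face (v, i)))
    simp only [Equiv.subRight_apply] at hshift
    rw [hshift]
    exact two _
  have hcard := P.card_edge_section S hS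
  have heuler := P.euler
  rw [Nat.card_eq_fintype_card] at heuler
  have hker := N.transpose.mulVecLin.finrank_range_add_finrank_ker
  have hrk := N.rank_transpose
  rw [Module.finrank_fintype_fun_eq_card, hcard] at hker
  unfold Matrix.rank at hrk rM rN
  -- Since `F = V + 2` by Euler's formula, the range has dimension at least `F - 1 = V + 1` and the
  -- kernel at most `2V - (V - 1) = V + 1`. So every cycle mod 2 bounds.
  have heq := Submodule.eq_of_le_of_finrank_le hle (by
    change Fintype.card P.Face ≤ _ at rM
    change (Fintype.card V : ℤ) - 2 * Fintype.card V + Fintype.card P.Face = 2 at heuler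
    omega)
  -- All degrees are even, so the set of all edges is a cycle. A set of faces bounded by it is one
  -- colour class.
  have hone : (fun _ => 1 : S → ZMod 2) ∈ LinearMap.ker N.transpose.mulVecLin := by
    rw [LinearMap.mem_ker, Matrix.mulVecLin_apply]
    ext v
    rw [hNT (fun _ => 1) fun _ => rfl]
    rw [Finset.sum_const, Finset.card_univ, ZMod.card]
    change (4 : ℕ) • (1 : ZMod 2) = 0
    decide
  rw [← heq] at hone
  obtain ⟨y, hy⟩ := hone
  have hodd : ∀ d, y (P.face d) + y (P.face (P.edge d)) = 1 := fun d => by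
    by_cases h : d ∈ S
    · rw [← hM y ⟨d, h⟩]; exact congrFun hy _
    · have := congrFun hy ⟨P.edge d, (hS d).2 h⟩
      rw [Matrix.mulVecLin_apply, hM, P.edge_edge, add_comm] at this
      exact this
  refine ⟨fun d => y (P.face d), fun d => by simp only [face_facePerm], fun d => ?_⟩
  have h1 := hodd (rot d)
  rw [← face_rot] at h1
  simp only
  generalize y (P.face (rot d)) = a at *
  generalize y (P.face d) = b at *
  revert a b
  decide

/-- Along any path the colouring changes exactly at the crossed edges, so the parity of a path
depends only on its end. Hence each corner has exactly one colour, and colours alternate around a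
vertex. -/
theorem exists_colour : ∃ w : V → ZMod 2, ∀ v i,
    (P.White (v, i) ↔ parity i = w v) ∧ (P.Black (v, i) ↔ parity i = w v + 1) := by
  obtain ⟨f, hface, hrot⟩ := P.exists_colouring
  have hpath : ∀ b c, P.PathParity b c → f c = f P.unbounded + b := fun b c h => by
    induction h with
    | start => simp
    | face _ ih => rw [hface, ih]
    | cross _ ih => rw [hrot, ih, add_assoc]
  have hex : ∀ c, ∃ b, P.PathParity b c := by
    have rotback : ∀ c, (∃ b, P.PathParity b (rot c)) → ∃ b, P.PathParity b c := by
      rintro ⟨v, i⟩ ⟨b, hb⟩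
      have := hb.cross.cross.cross
      simp only [rot_apply, add_assoc] at this
      rw [show (1 + (1 + (1 + 1)) : ZMod 4) = 0 from by decide, add_zero] at this
      exact ⟨_, this⟩
    have step : ∀ c, (∃ b, P.PathParity b c) → ∃ b, P.PathParity b (P.edge c) := by
      rintro c ⟨b, hb⟩
      have := hb.face.cross
      rw [rot_facePerm] at this
      exact ⟨_, this⟩
    have key := P.eq_of_invariant (fun c => ∃ b, P.PathParity b c)
      (fun d => propext ⟨rotback d, fun ⟨b, hb⟩ => ⟨_, hb.cross⟩⟩)
      (fun d => propext ⟨fun h => by simpa [P.edge_edge] using step _ h, step d⟩)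
    intro c
    rw [key c P.unbounded]
    exact ⟨0, .start⟩
  have hiff : ∀ b c, P.PathParity b c ↔ f c = f P.unbounded + b := fun b c => by
    refine ⟨hpath b c, fun h => ?_⟩
    obtain ⟨b', hb'⟩ := hex c
    have := hpath b' c hb'
    rw [this, add_right_inj] at h
    exact h ▸ hb'
  have hpar : ∀ v i, f (v, i) = f (v, 0) + parity i := by
    intro v
    have h0 := hrot (v, 0)
    have h1 := hrot (v, 1)
    have h2 := hrot (v, 2)
    simp only [rot_apply] at h0 h1 h2
    rw [show (0 + 1 : ZMod 4) = 1 from rfl] at h0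
    rw [show (1 + 1 : ZMod 4) = 2 from rfl, h0] at h1
    rw [show (2 + 1 : ZMod 4) = 3 from rfl, h1] at h2
    intro i
    fin_cases i
    · exact (add_zero _).symm
    · exact h0
    · exact h1.trans (by rw [add_assoc]; rfl)
    · exact h2.trans (by rw [add_assoc, add_assoc]; rfl)
  refine ⟨fun v => f P.unbounded - f (v, 0), fun v i => ?_⟩
  simp only [White, Black, hiff, hpar v i]
  generalize parity i = x
  generalize f (v, 0) = y
  generalize f P.unbounded = z
  revert x y z
  decide

end PlaneGraph
end Colouring

/-! ### Colours of the corners at a vertex -/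

section Skein

theorem eq_or_eq_add_two_of_parity_eq :
    ∀ i j : ZMod 4, parity i = parity j → j = i ∨ j = i + 2 := by
  decide

theorem parity_add_two : ∀ i : ZMod 4, parity (i + 2) = parity i := by decide

theorem parity_add_one : ∀ i : ZMod 4, parity (i + 1) = parity i + 1 := by decide

theorem exists_parity_eq : ∀ a : ZMod 2, ∃ i : ZMod 4, parity i = a := by decide

theorem zmodTwo_eq_or (a b : ZMod 2) : a = b ∨ a = b + 1 := by revert a b; decide

theorem zmodTwo_ne_add_one (a : ZMod 2) : a ≠ a + 1 := by revert a; decide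

theorem add_two_add_two (i : ZMod 4) : i + 2 + 2 = i := by revert i; decide

variable {V : Type*} [Fintype V]

namespace PlaneGraph
variable (P : PlaneGraph V)

/-- The parity of the white corners at a vertex. -/
noncomputable def whiteParity : V → ZMod 2 := P.exists_colour.choose

theorem white_iff (v : V) (i : ZMod 4) : P.White (v, i) ↔ parity i = P.whiteParity v :=
  (P.exists_colour.choose_spec v i).1

theorem black_iff (v : V) (i : ZMod 4) : P.Black (v, i) ↔ parity i = P.whiteParity v + 1 :=
  (P.exists_colour.choose_spec v i).2

theorem white_facePerm_iff (c : Dart V) : P.White (facePerm P.edge c) ↔ P.White c := by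
  refine ⟨fun h => ?_, fun h => h.face⟩
  obtain ⟨v, i⟩ := c
  rcases zmodTwo_eq_or (parity i) (P.whiteParity v) with hc | hc
  · exact (P.white_iff v i).2 hc
  · have hb : P.Black (facePerm P.edge (v, i)) := ((P.black_iff v i).2 hc).face
    generalize facePerm P.edge (v, i) = d at h hb
    obtain ⟨u, j⟩ := d
    rw [P.white_iff] at h
    rw [P.black_iff, h] at hb
    exact absurd hb (zmodTwo_ne_add_one _)

theorem black_iff_not_white (c : Dart V) : P.Black c ↔ ¬ P.White c := by
  obtain ⟨v, i⟩ := c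
  rw [P.black_iff, P.white_iff]
  generalize parity i = a
  generalize P.whiteParity v = b
  revert a b; decide

/-- A white corner at a vertex. -/
noncomputable def whiteCorner (v : V) : ZMod 4 := (exists_parity_eq (P.whiteParity v)).choose

theorem parity_whiteCorner (v : V) : parity (P.whiteCorner v) = P.whiteParity v :=
  (exists_parity_eq (P.whiteParity v)).choose_spec

theorem white_whiteCorner (v : V) : P.White (v, P.whiteCorner v) :=
  (P.white_iff _ _).2 (P.parity_whiteCorner v)

theorem white_add_two (v : V) (i : ZMod 4) : P.White (v, i + 2) ↔ P.White (v, i) := by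
  rw [P.white_iff, P.white_iff, parity_add_two]

end PlaneGraph

/-! ### The Goeritz matrix as an incidence form -/

namespace Diagram
variable {P : PlaneGraph V} (D : Diagram P)

theorem eta_of_crossing {v : V} {a : ZMod 2} (h : D.filling v = .crossing a) :
    D.eta v = if a = P.whiteParity v + 1 then 1 else -1 := by
  have : (∃ i, parity i = a ∧ P.Black (v, i)) ↔ a = P.whiteParity v + 1 := by
    constructor
    · rintro ⟨i, rfl, hi⟩
      exact (P.black_iff v i).1 hi
    · rintro rfl
      obtain ⟨i, hi⟩ := exists_parity_eq (P.whiteParity v + 1)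
      exact ⟨i, hi, (P.black_iff v i).2 hi⟩
  simp only [eta, h, this]

theorem eta_eq_one_or (v : V) (h : D.IsCrossing v) : D.eta v = 1 ∨ D.eta v = -1 := by
  obtain ⟨a, ha⟩ := h
  rw [D.eta_of_crossing ha]
  split_ifs <;> simp

theorem eta_of_not_isCrossing {v : V} (h : ¬ D.IsCrossing v) : D.eta v = 0 := by
  cases hf : D.filling v with
  | crossing a => exact absurd ⟨a, hf⟩ h
  | smoothing a => simp [eta, hf]

theorem eta_congr {D D' : Diagram P} {v : V} (h : D'.filling v = D.filling v) :
    D'.eta v = D.eta v := by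
  simp only [eta, h]

theorem white_iff_of_joined {c c' : Dart V} (h : D.Joined c c') : P.White c ↔ P.White c' := by
  rcases h with rfl | ⟨v, i, rfl, rfl, -⟩
  · exact (P.white_facePerm_iff c).symm
  · exact (P.white_add_two v i).symm

/-- The underlying region of a white region. -/
def WhiteRegion.toRegion {D : Diagram P} (r : D.WhiteRegion) : D.Region := r.1

theorem WhiteRegion.toRegion_injective :
    Function.Injective (WhiteRegion.toRegion (D := D)) := fun _ _ h => Subtype.ext h

/-- The white region in which a white corner lies. -/
def whiteRegion (c : Dart V) (hc : P.White c) : D.WhiteRegion := ⟨D.region c, c, hc, rfl⟩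

open scoped Classical in
/-- The incidence numbers of a crossing with the regions, for a fixed order of its two white
corners. -/
noncomputable def incidence (v : V) (r : D.Region) : ℤ :=
  (if D.region (v, P.whiteCorner v) = r then 1 else 0)
    - (if D.region (v, P.whiteCorner v + 2) = r then 1 else 0)

theorem connects_iff {v : V} (h : D.IsCrossing v) (r s : D.WhiteRegion) : D.Connects v r s ↔
    (D.region (v, P.whiteCorner v) = r.toRegion ∧ D.region (v, P.whiteCorner v + 2) = s.toRegion) ∨
    (D.region (v, P.whiteCorner v + 2) = r.toRegion ∧ D.region (v, P.whiteCorner v) = s.toRegion) := by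
  constructor
  · rintro ⟨-, i, hi, h1, h2⟩
    rw [P.white_iff, ← P.parity_whiteCorner] at hi
    rcases eq_or_eq_add_two_of_parity_eq _ _ hi.symm with rfl | rfl
    · exact .inl ⟨h1, h2⟩
    · rw [add_two_add_two] at h2
      exact .inr ⟨h1, h2⟩
  · rintro (⟨h1, h2⟩ | ⟨h1, h2⟩)
    · exact ⟨h, _, P.white_whiteCorner v, h1, h2⟩
    · refine ⟨h, _, (P.white_add_two _ _).2 (P.white_whiteCorner v), h1, ?_⟩
      rwa [add_two_add_two]

open scoped Classical in
-- For distinct regions the product of incidences is -1 if the crossing connects them and 0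
-- otherwise, which absorbs the minus sign of the Goeritz entry.
theorem goeritzEntry_eq (r s : D.WhiteRegion) (hrs : r ≠ s) :
    D.goeritzEntry r s = ∑ v, D.eta v * (D.incidence v r.toRegion * D.incidence v s.toRegion) := by
  rw [goeritzEntry, Finset.sum_filter, ← Finset.sum_neg_distrib]
  refine Finset.sum_congr rfl fun v _ => ?_
  by_cases hv : D.IsCrossing v
  · rw [D.connects_iff hv]
    have hrs' : r.toRegion ≠ s.toRegion := fun h => hrs (WhiteRegion.toRegion_injective D h)
    unfold incidence
    generalize D.region (v, P.whiteCorner v) = x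
    generalize D.region (v, P.whiteCorner v + 2) = y
    by_cases h1 : x = r.toRegion <;> by_cases h2 : y = r.toRegion <;> by_cases h3 : x = s.toRegion <;>
      by_cases h4 : y = s.toRegion <;> simp_all
  · simp [D.eta_of_not_isCrossing hv]

theorem sum_incidence (v : V) : ∑ r : D.WhiteRegion, D.incidence v r.toRegion = 0 := by
  classical
  have key : ∀ c, P.White c → ∑ r : D.WhiteRegion, (if D.region c = r.toRegion then (1 : ℤ) else 0) = 1 :=
    fun c hc => by
      rw [Finset.sum_eq_single (D.whiteRegion c hc)]
      · exact if_pos rfl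
      · intro b _ hb
        exact if_neg fun h => hb (WhiteRegion.toRegion_injective D h.symm)
      · simp
  simp only [incidence, Finset.sum_sub_distrib]
  have h1 := key _ (P.white_whiteCorner v)
  have h2 := key _ ((P.white_add_two _ _).2 (P.white_whiteCorner v))
  convert sub_self (1 : ℤ)

/-- The diagonal entries are fixed by vanishing row sums, and the incidence form has these by
`sum_incidence`. -/
theorem unreducedGoeritz_apply (r s : D.WhiteRegion) :
    D.unreducedGoeritz r s = ∑ v, D.eta v * (D.incidence v r.toRegion * D.incidence v s.toRegion) := by
  classical
  simp only [unreducedGoeritz, Matrix.of_apply]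
  split_ifs with h
  · subst h
    have h1 : ∀ k ∈ Finset.univ.filter (fun k => k ≠ r), D.goeritzEntry r k =
        ∑ v, D.eta v * (D.incidence v r.toRegion * D.incidence v k.toRegion) := fun k hk =>
      D.goeritzEntry_eq r k (by simpa using (Finset.mem_filter.1 hk).2.symm)
    have h3 : ∀ v, ∑ k with k ≠ r, D.incidence v k.toRegion = - D.incidence v r.toRegion := fun v => by
      have := D.sum_incidence v
      rw [← Finset.add_sum_erase _ _ (Finset.mem_univ r)] at this
      rw [Finset.filter_ne']
      linarith
    rw [Finset.sum_congr rfl h1, Finset.sum_comm, ← Finset.sum_neg_distrib]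
    refine Finset.sum_congr rfl fun v _ => ?_
    rw [← Finset.mul_sum, ← Finset.mul_sum, h3]
    ring
  · exact D.goeritzEntry_eq r s h

/-- The underlying region of a bounded white region. -/
def BoundedWhiteRegion.toRegion {D : Diagram P} (r : D.BoundedWhiteRegion) : D.Region :=
  WhiteRegion.toRegion r.1

theorem BoundedWhiteRegion.toRegion_injective :
    Function.Injective (BoundedWhiteRegion.toRegion (D := D)) := fun _ _ h =>
  Subtype.ext (Subtype.ext h)

theorem BoundedWhiteRegion.exists_white {D : Diagram P} (r : D.BoundedWhiteRegion) :
    ∃ c, P.White c ∧ D.region c = r.toRegion := r.1.2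

theorem BoundedWhiteRegion.toRegion_ne {D : Diagram P} (r : D.BoundedWhiteRegion) :
    r.toRegion ≠ D.region P.unbounded := r.2

/-- The bounded white region given by a region. -/
def boundedWhiteRegion (x : D.Region) (hx : ∃ c, P.White c ∧ D.region c = x)
    (hb : x ≠ D.region P.unbounded) : D.BoundedWhiteRegion := ⟨⟨x, hx⟩, hb⟩

@[simp] theorem toRegion_boundedWhiteRegion (x : D.Region) (hx : ∃ c, P.White c ∧ D.region c = x)
    (hb : x ≠ D.region P.unbounded) : (D.boundedWhiteRegion x hx hb).toRegion = x := rfl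

/-- The incidence numbers of the crossings with the bounded white regions. -/
noncomputable def incidenceMatrix : Matrix V D.BoundedWhiteRegion ℤ :=
  Matrix.of fun v r => D.incidence v r.toRegion

open Matrix

open scoped Classical in
/-- The Goeritz form with arbitrary weights of the crossings. -/
noncomputable def weightedGoeritz (η : V → ℤ) :
    Matrix D.BoundedWhiteRegion D.BoundedWhiteRegion ℤ :=
  D.incidenceMatrixᵀ * diagonal η * D.incidenceMatrix

theorem weightedGoeritz_apply (η : V → ℤ) (r s : D.BoundedWhiteRegion) :
    D.weightedGoeritz η r s = ∑ v, η v * (D.incidence v r.toRegion * D.incidence v s.toRegion) := by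
  classical
  rw [weightedGoeritz, Matrix.mul_apply]
  refine Finset.sum_congr rfl fun v _ => ?_
  rw [mul_diagonal]
  simp only [incidenceMatrix, transpose_apply, of_apply]
  ring

theorem goeritz_eq : D.goeritz = D.weightedGoeritz D.eta := by
  ext r s
  rw [weightedGoeritz_apply]
  exact D.unreducedGoeritz_apply r.1 s.1

theorem weightedGoeritz_isSymm (η : V → ℤ) : (D.weightedGoeritz η).IsSymm := by
  classical
  simp [IsSymm, weightedGoeritz, Matrix.mul_assoc]

/-- `D'` arises from `D` by smoothing the crossing `p`, connecting the corners of parity `a`. -/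
structure IsSmoothing (p : V) (a : ZMod 2) (D D' : Diagram P) : Prop where
  crossing : D.IsCrossing p
  smoothing : D'.filling p = .smoothing a
  outside : ∀ v, v ≠ p → D'.filling v = D.filling v

namespace IsSmoothing
variable {D} {p : V} {a : ZMod 2} {D' : Diagram P}

theorem joined_iff (h : IsSmoothing p a D D') (c c' : Dart V) : D'.Joined c c' ↔
    D.Joined c c' ∨ ∃ i, parity i = a ∧ c = (p, i) ∧ c' = (p, i + 2) := by
  constructor
  · rintro (hc | ⟨v, i, rfl, rfl, hf⟩)
    · exact .inl (.inl hc)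
    · by_cases hv : v = p
      · subst hv
        rw [h.smoothing] at hf
        injection hf with hf
        exact .inr ⟨i, hf.symm, rfl, rfl⟩
      · exact .inl (.inr ⟨v, i, rfl, rfl, by rw [← h.outside v hv, hf]⟩)
  · rintro ((hc | ⟨v, i, rfl, rfl, hf⟩) | ⟨i, hi, rfl, rfl⟩)
    · exact .inl hc
    · by_cases hv : v = p
      · subst hv
        obtain ⟨b, hb⟩ := h.crossing
        rw [hb] at hf
        cases hf
      · exact .inr ⟨v, i, rfl, rfl, by rw [h.outside v hv, hf]⟩
    · exact .inr ⟨p, i, rfl, rfl, by rw [h.smoothing, hi]⟩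

theorem isCrossing_iff (h : IsSmoothing p a D D') (v : V) : D'.IsCrossing v ↔ v ≠ p ∧ D.IsCrossing v := by
  by_cases hv : v = p
  · subst hv
    simp [IsCrossing, h.smoothing]
  · simp [IsCrossing, h.outside v hv, hv]

theorem eta_self (h : IsSmoothing p a D D') : D'.eta p = 0 := D'.eta_of_not_isCrossing (by simp [h.isCrossing_iff])

theorem eta_of_ne (h : IsSmoothing p a D D') {v : V} (hv : v ≠ p) : D'.eta v = D.eta v := eta_congr (h.outside v hv)

/-- The region of the smoothed diagram that contains a given region. -/
def toSmoothed (h : IsSmoothing p a D D') : D.Region → D'.Region :=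
  Quot.map id fun c c' hc => (h.joined_iff c c').2 (.inl hc)

theorem toSmoothed_region (h : IsSmoothing p a D D') (c : Dart V) :
    h.toSmoothed (D.region c) = D'.region c := rfl

theorem region_eq_of_region_eq (h : IsSmoothing p a D D') {c c' : Dart V} (hc : D.region c = D.region c') :
    D'.region c = D'.region c' := by
  rw [← h.toSmoothed_region, hc, h.toSmoothed_region]

theorem region_opposite (h : IsSmoothing p a D D') {i : ZMod 4} (hi : parity i = a) : D'.region (p, i) = D'.region (p, i + 2) :=
  Quot.sound ((h.joined_iff _ _).2 (.inr ⟨i, hi, rfl, rfl⟩))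

end IsSmoothing
end Diagram

/-! ### Smoothings, white regions and the Goeritz form -/

namespace Diagram
variable {P : PlaneGraph V} {D : Diagram P}
namespace IsSmoothing
variable {p : V} {a : ZMod 2} {D' : Diagram P}

/-- The two weight functions differ only at `p`, and a single crossing contributes a form of rank at
most one. -/
theorem weightedGoeritz_eta (h : IsSmoothing p a D D') : D.weightedGoeritz D.eta =
    D.weightedGoeritz D'.eta + D.eta p • vecMulVec (D.incidenceMatrix p) (D.incidenceMatrix p) := by
  classical
  ext r s
  simp only [weightedGoeritz_apply, Matrix.add_apply, Matrix.smul_apply, vecMulVec_apply,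
    incidenceMatrix, of_apply, smul_eq_mul]
  rw [← Finset.add_sum_erase _ _ (Finset.mem_univ p), ← Finset.add_sum_erase
    (f := fun v => D'.eta v * _) _ (Finset.mem_univ p), h.eta_self]
  rw [Finset.sum_congr rfl fun v hv => by rw [← h.eta_of_ne (Finset.ne_of_mem_erase hv)]]
  ring

/-- If smoothing does not merge white regions, the Goeritz forms agree up to a change of weights. -/
theorem exists_equiv_of_injective (h : IsSmoothing p a D D')
    (hinj : ∀ c c', P.White c → P.White c' → D'.region c = D'.region c' → D.region c = D.region c') :
    ∃ e : D.BoundedWhiteRegion ≃ D'.BoundedWhiteRegion,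
      ∀ η, (D'.weightedGoeritz η).submatrix e e = D.weightedGoeritz η := by
  classical
  have hunb : P.White P.unbounded := .start
  have hne : ∀ r : D.BoundedWhiteRegion, h.toSmoothed r.toRegion ≠ D'.region P.unbounded := by
    intro r hr
    obtain ⟨c, hc, hcr⟩ := r.exists_white
    rw [← hcr, h.toSmoothed_region] at hr
    exact r.toRegion_ne (hcr ▸ hinj _ _ hc hunb hr)
  let f : D.BoundedWhiteRegion → D'.BoundedWhiteRegion := fun r =>
    D'.boundedWhiteRegion (h.toSmoothed r.toRegion)
      (by obtain ⟨c, hc, hcr⟩ := r.exists_white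
          exact ⟨c, hc, by rw [← hcr, h.toSmoothed_region]⟩) (hne r)
  have hf : ∀ r c, P.White c → (D'.region c = (f r).toRegion ↔ D.region c = r.toRegion) := by
    intro r c hc
    obtain ⟨c', hc', hcr⟩ := r.exists_white
    simp only [f, toRegion_boundedWhiteRegion]
    rw [← hcr, h.toSmoothed_region]
    exact ⟨hinj _ _ hc hc', h.region_eq_of_region_eq⟩
  have hbij : Function.Bijective f := by
    constructor
    · intro r s hrs
      obtain ⟨c, hc, hcr⟩ := r.exists_white
      have h1 := (hf r c hc).2 hcr
      rw [hrs, hf s c hc, hcr] at h1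
      exact BoundedWhiteRegion.toRegion_injective D h1
    · intro r'
      obtain ⟨c, hc, hcr⟩ := r'.exists_white
      refine ⟨D.boundedWhiteRegion (D.region c) ⟨c, hc, rfl⟩ fun h0 => ?_, ?_⟩
      · exact r'.toRegion_ne (hcr ▸ h.region_eq_of_region_eq h0)
      · exact BoundedWhiteRegion.toRegion_injective D' hcr
  refine ⟨Equiv.ofBijective f hbij, fun η => ?_⟩
  have hinc : ∀ v r, D'.incidence v (f r).toRegion = D.incidence v r.toRegion := fun v r => by
    simp only [incidence, hf r _ (P.white_whiteCorner v),
      hf r _ ((P.white_add_two _ _).2 (P.white_whiteCorner v))]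
  ext r s
  rw [submatrix_apply, weightedGoeritz_apply, weightedGoeritz_apply]
  simp only [Equiv.ofBijective_apply, hinc]

/-- The only new identification is between black corners, so the region of `D` at a white corner,
with `none` at black corners, is well defined on the regions of `D'`. -/
theorem injective_of_black (h : IsSmoothing p a D D') (ha : a = P.whiteParity p + 1)
    (c c' : Dart V) (hc : P.White c) (hc' : P.White c') (hcc : D'.region c = D'.region c') :
    D.region c = D.region c' := by
  classical
  have key : ∀ x y, D'.Joined x y → (if P.White x then some (D.region x) else none) =
      (if P.White y then some (D.region y) else none) := by
    intro x y hxy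
    have hw := D'.white_iff_of_joined hxy
    rw [h.joined_iff] at hxy
    rcases hxy with hxy | ⟨i, hi, rfl, rfl⟩
    · rw [show D.region x = D.region y from Quot.sound hxy]
      simp only [hw]
    · have hb : P.Black (p, i) := (P.black_iff p i).2 (hi.trans ha)
      rw [P.black_iff_not_white] at hb
      simp [hb, ← hw]
  have := congrArg (Quot.lift _ key) hcc
  change (if P.White c then some (D.region c) else none) =
      (if P.White c' then some (D.region c') else none) at this
  simpa [hc, hc'] using this

open scoped Classical in
/-- A section of `toSmoothed`: the region at the corner `i` is replaced by the opposite one, with which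
the smoothing merges it. -/
noncomputable def fromSmoothed (h : IsSmoothing p a D D') (i : ZMod 4) (hi : parity i = a) : D'.Region → D.Region :=
  Quot.lift (fun c => if D.region c = D.region (p, i) then D.region (p, i + 2) else D.region c) (by
    intro x y hxy
    rw [h.joined_iff] at hxy
    rcases hxy with hxy | ⟨j, hj, rfl, rfl⟩
    · rw [show D.region x = D.region y from Quot.sound hxy]
    · rcases eq_or_eq_add_two_of_parity_eq i j (hi.trans hj.symm) with rfl | rfl
      · rw [if_pos rfl]; split_ifs <;> rfl
      · rw [add_two_add_two, if_pos rfl]; split_ifs <;> rfl)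

open scoped Classical in
theorem fromSmoothed_region (h : IsSmoothing p a D D') (i : ZMod 4) (hi : parity i = a) (c : Dart V) :
    h.fromSmoothed i hi (D'.region c) =
      if D.region c = D.region (p, i) then D.region (p, i + 2) else D.region c := rfl

theorem toSmoothed_fromSmoothed (h : IsSmoothing p a D D') (i : ZMod 4) (hi : parity i = a)
    (r : D'.Region) : h.toSmoothed (h.fromSmoothed i hi r) = r := by
  induction r using Quot.ind with | _ c
  change h.toSmoothed (h.fromSmoothed i hi (D'.region c)) = D'.region c
  rw [fromSmoothed_region]
  split_ifs with hc
  · rw [toSmoothed_region, ← h.region_opposite hi]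
    exact (h.region_eq_of_region_eq hc).symm
  · rfl

/-- If the opposite corners already share a region, `fromSmoothed` replaces that region by itself
and so recovers every region of `D`. -/
theorem injective_of_eq (h : IsSmoothing p a D D') (i : ZMod 4) (hi : parity i = a)
    (heq : D.region (p, i) = D.region (p, i + 2)) (c c' : Dart V)
    (hcc : D'.region c = D'.region c') : D.region c = D.region c' := by
  have := congrArg (h.fromSmoothed i hi) hcc
  rw [fromSmoothed_region, fromSmoothed_region, ← heq] at this
  split_ifs at this with h1 h2 h2
  · rw [h1, h2]
  · rw [h1, this]
  · rw [this, h2]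
  · exact this

open scoped Classical in
/-- The matrix that expresses bounded white regions of the smoothed diagram by those of the diagram. -/
noncomputable def transfer (h : IsSmoothing p a D D') :
    Matrix D.BoundedWhiteRegion D'.BoundedWhiteRegion ℤ :=
  Matrix.of fun r r' => if h.toSmoothed r.toRegion = r'.toRegion then 1 else 0

/-- Incidences of the merged regions add up. A bounded region merged with the unbounded one has a
zero row in `transfer`, matching the deletion of the unbounded column. -/
theorem incidenceMatrix_mul_transfer (h : IsSmoothing p a D D') :
    D.incidenceMatrix * h.transfer = D'.incidenceMatrix := by
  classical
  ext v r'
  have key : ∀ c, P.White c → ∑ r : D.BoundedWhiteRegion,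
      (if D.region c = r.toRegion then (1 : ℤ) else 0) * h.transfer r r' =
        if D'.region c = r'.toRegion then 1 else 0 := by
    intro c hc
    by_cases hb : D.region c = D.region P.unbounded
    · rw [Finset.sum_eq_zero fun r _ => by
        rw [if_neg fun h0 => r.toRegion_ne (h0.symm.trans hb), zero_mul], if_neg]
      intro h0
      exact r'.toRegion_ne (h0.symm.trans (h.region_eq_of_region_eq hb))
    · rw [Finset.sum_eq_single (D.boundedWhiteRegion (D.region c) ⟨c, hc, rfl⟩ hb)]
      · simp only [toRegion_boundedWhiteRegion, transfer, of_apply, toSmoothed_region, if_true, one_mul]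
        congr
      · intro r _ hr
        rw [if_neg fun h0 => hr (BoundedWhiteRegion.toRegion_injective D h0.symm), zero_mul]
      · simp
  rw [Matrix.mul_apply]
  simp only [incidenceMatrix, of_apply, incidence, sub_mul, Finset.sum_sub_distrib]
  have h1 := key _ (P.white_whiteCorner v)
  have h2 := key _ ((P.white_add_two _ _).2 (P.white_whiteCorner v))
  rw [h1, h2]

theorem weightedGoeritz_smoothed (h : IsSmoothing p a D D') (η : V → ℤ) :
    D'.weightedGoeritz η = h.transferᵀ * D.weightedGoeritz η * h.transfer := by
  simp only [weightedGoeritz, ← h.incidenceMatrix_mul_transfer, transpose_mul, Matrix.mul_assoc]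

/-- When two distinct regions are merged, the first of them bounded, the bounded white regions of the
diagram are those of the smoothed diagram and this one. -/
theorem exists_equiv_of_ne (h : IsSmoothing p a D D') (ha : a = P.whiteParity p)
    (i : ZMod 4) (hi : parity i = a)
    (hne : D.region (p, i) ≠ D.region (p, i + 2))
    (hb : D.region (p, i) ≠ D.region P.unbounded) :
    ∃ e : D'.BoundedWhiteRegion ⊕ Unit ≃ D.BoundedWhiteRegion,
      (e (.inr ())).toRegion = D.region (p, i) ∧
      ∀ r, h.toSmoothed (e (.inl r)).toRegion = r.toRegion := by
  classical
  have hw : P.White (p, i) := (P.white_iff p i).2 (hi.trans ha)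
  have hsec : ∀ r : D'.BoundedWhiteRegion,
      h.fromSmoothed i hi r.toRegion ≠ D.region P.unbounded := fun r h0 => by
    have := congrArg h.toSmoothed h0
    rw [toSmoothed_fromSmoothed, toSmoothed_region] at this
    exact r.toRegion_ne this
  have hsecne : ∀ r : D'.Region, h.fromSmoothed i hi r ≠ D.region (p, i) := fun r => by
    induction r using Quot.ind with | _ c
    change h.fromSmoothed i hi (D'.region c) ≠ _
    rw [fromSmoothed_region]
    split_ifs with h1
    · exact hne.symm
    · exact h1
  let f : D'.BoundedWhiteRegion ⊕ Unit → D.BoundedWhiteRegion := Sum.elim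
    (fun r => D.boundedWhiteRegion (h.fromSmoothed i hi r.toRegion) (by
      obtain ⟨c, hc, hcr⟩ := r.exists_white
      rw [← hcr, fromSmoothed_region]
      split_ifs with h1
      · exact ⟨_, (P.white_add_two _ _).2 hw, rfl⟩
      · exact ⟨c, hc, rfl⟩) (hsec r))
    (fun _ => D.boundedWhiteRegion (D.region (p, i)) ⟨_, hw, rfl⟩ hb)
  have hf1 : ∀ r, (f (.inl r)).toRegion = h.fromSmoothed i hi r.toRegion := fun r => rfl
  have hf2 : ∀ u, (f (.inr u)).toRegion = D.region (p, i) := fun r => rfl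
  have hbij : Function.Bijective f := by
    constructor
    · rintro (r | r) (s | s) hrs
      · have := congrArg (fun x => h.toSmoothed x.toRegion) hrs
        simp only [hf1, toSmoothed_fromSmoothed] at this
        rw [BoundedWhiteRegion.toRegion_injective D' this]
      · exact absurd (congrArg BoundedWhiteRegion.toRegion hrs) (hsecne _)
      · exact absurd (congrArg BoundedWhiteRegion.toRegion hrs).symm (hsecne _)
      · rfl
    · intro r
      by_cases hr : r.toRegion = D.region (p, i)
      · exact ⟨.inr (), BoundedWhiteRegion.toRegion_injective D hr.symm⟩
      · obtain ⟨c, hc, hcr⟩ := r.exists_white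
        by_cases hu : D'.region c = D'.region P.unbounded
        · have := congrArg (h.fromSmoothed i hi) hu
          rw [fromSmoothed_region, fromSmoothed_region, if_neg (hcr ▸ hr), if_neg hb.symm, hcr] at this
          exact absurd this r.toRegion_ne
        · refine ⟨.inl (D'.boundedWhiteRegion (D'.region c) ⟨c, hc, rfl⟩ hu),
            BoundedWhiteRegion.toRegion_injective D ?_⟩
          rw [hf1, toRegion_boundedWhiteRegion, fromSmoothed_region, if_neg (hcr ▸ hr), hcr]
  exact ⟨Equiv.ofBijective f hbij, hf2 (), fun r => h.toSmoothed_fromSmoothed i hi _⟩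

end IsSmoothing
end Diagram

/-! ### The skein relation for Goeritz determinants and signatures -/

theorem matrixSignature_submatrix {m n : Type*} [Fintype m] [Fintype n] (M : Matrix n n ℤ)
    (e : m ≃ n) : matrixSignature (M.submatrix e e) = matrixSignature M := by
  classical
  rw [matrixSignature_eq_realSignature, matrixSignature_eq_realSignature, ← submatrix_map,
    realSignature_submatrix]

theorem det_map_intCast {n R : Type*} [Fintype n] [DecidableEq n] [CommRing R] (M : Matrix n n ℤ) :
    (M.map (Int.cast : ℤ → R)).det = (M.det : R) :=
  ((Int.castRingHom R).map_det M).symm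

/-- Integral version of `abs_det_rankOne_update_iff`; `e` singles out the coordinate not covered by
`T`. -/
theorem abs_det_rankOne_update_iff_int {m n : Type*} [Fintype m] [Fintype n] [DecidableEq m]
    [DecidableEq n] (A : Matrix n n ℤ) (hA : A.IsSymm) (T : Matrix n m ℤ) (e : m ⊕ Unit ≃ n)
    (hT : ∀ j j', T (e (.inl j)) j' = if j = j' then 1 else 0)
    (v : n → ℤ) (η : ℤ) (hη : η = 1 ∨ η = -1) (hv : v (e (.inr ())) * v (e (.inr ())) = 1)
    (hvT : v ᵥ* T = 0) (hdA : A.det ≠ 0) (hdC : (Tᵀ * A * T).det ≠ 0) :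
    |(A + η • vecMulVec v v).det| = |A.det| + |(Tᵀ * A * T).det| ↔
      matrixSignature (A + η • vecMulVec v v) = matrixSignature A ∧
      matrixSignature (A + η • vecMulVec v v) = matrixSignature (Tᵀ * A * T) + η := by
  let c : ℤ → ℝ := Int.cast
  have hC : (Tᵀ * A * T).map c = (((T.map c).submatrix e id)ᵀ * (A.map c).submatrix e e) *
      (T.map c).submatrix e id := by
    have h1 := Matrix.map_mul (L := Tᵀ * A) (M := T) (f := Int.castRingHom ℝ)
    have h2 := Matrix.map_mul (L := Tᵀ) (M := A) (f := Int.castRingHom ℝ)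
    change (Tᵀ * A * T).map c = (Tᵀ * A).map c * T.map c at h1
    change (Tᵀ * A).map c = Tᵀ.map c * A.map c at h2
    rw [transpose_submatrix, submatrix_mul_equiv, submatrix_mul_equiv]
    exact h1.trans (by rw [h2]; rfl)
  have hupd : (A + η • vecMulVec v v).map c =
      A.map c + (η : ℝ) • vecMulVec (fun x => (v x : ℝ)) (fun x => (v x : ℝ)) := by
    ext x y
    simp only [map_apply, Matrix.add_apply, Matrix.smul_apply, vecMulVec_apply, smul_eq_mul, c]
    push_cast
    rfl
  have hupd' : ((A + η • vecMulVec v v).map c).submatrix e e = (A.map c).submatrix e e +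
      (η : ℝ) • vecMulVec (fun x => (v (e x) : ℝ)) (fun x => (v (e x) : ℝ)) := by
    rw [hupd]; ext x y; simp [vecMulVec_apply]
  have hsign : ((SignType.sign (η : ℝ) : SignType) : ℤ) = η := by
    rcases hη with rfl | rfl <;> simp
  have key := abs_det_rankOne_update_iff ((A.map c).submatrix e e)
    (by
      have := congrArg (fun M : Matrix n n ℤ => (M.map c).submatrix e e) hA.eq
      exact this)
    ((T.map c).submatrix e id)
    (by ext j j'; simp [toRows₁, hT, one_apply, c])
    ((Tᵀ * A * T).map c) hC (fun x => (v (e x) : ℝ)) η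
    (by rcases hη with rfl | rfl <;> simp)
    (by exact_mod_cast hv)
    (by
      ext j
      have := congrFun hvT j
      simp only [vecMul, dotProduct, Pi.zero_apply] at this
      rw [← e.sum_comp] at this
      simp only [vecMul, dotProduct, submatrix_apply, map_apply, id, c, Pi.zero_apply]
      exact_mod_cast this)
    (by rw [det_submatrix_equiv_self, det_map_intCast]; exact_mod_cast hdA)
    (by rw [det_map_intCast]; exact_mod_cast hdC)
  rw [← hupd', det_submatrix_equiv_self, det_submatrix_equiv_self, realSignature_submatrix,
    realSignature_submatrix, det_map_intCast, det_map_intCast, det_map_intCast, hsign] at key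
  rw [matrixSignature_eq_realSignature, matrixSignature_eq_realSignature,
    matrixSignature_eq_realSignature, ← key]
  norm_cast

namespace Diagram
variable {P : PlaneGraph V} {D DB DW : Diagram P} {p : V}

open scoped Classical in
/-- The skein relation of Goeritz forms: `DB` merges the black corners at `p`, `DW` the white ones. -/
theorem abs_det_goeritz_iff (hB : IsSmoothing p (P.whiteParity p + 1) D DB)
    (hW : IsSmoothing p (P.whiteParity p) D DW)
    (hdB : DB.goeritz.det ≠ 0) (hdW : DW.goeritz.det ≠ 0) :
    |D.goeritz.det| = |DB.goeritz.det| + |DW.goeritz.det| ↔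
      matrixSignature D.goeritz = matrixSignature DB.goeritz ∧
      matrixSignature D.goeritz = matrixSignature DW.goeritz + D.eta p := by
  have hηp := D.eta_eq_one_or p hB.crossing
  have heta : DW.eta = DB.eta := by
    ext v
    by_cases hv : v = p
    · subst hv; rw [hB.eta_self, hW.eta_self]
    · rw [hB.eta_of_ne hv, hW.eta_of_ne hv]
  obtain ⟨eB, heB⟩ := hB.exists_equiv_of_injective (hB.injective_of_black rfl)
  have hDB := heB DB.eta
  rw [← goeritz_eq] at hDB
  have hdetB : DB.goeritz.det = (D.weightedGoeritz DB.eta).det := by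
    rw [← hDB, det_submatrix_equiv_self]
  have hsigB : matrixSignature DB.goeritz = matrixSignature (D.weightedGoeritz DB.eta) := by
    rw [← hDB, matrixSignature_submatrix]
  rw [hsigB, hdetB]
  have hD : D.goeritz = _ := D.goeritz_eq.trans hB.weightedGoeritz_eta
  -- If both white corners at `p` lie in one region, row `p` vanishes and the three forms coincide:
  -- both sides of the equivalence are false, since the determinant and `η` are nonzero.
  by_cases hloop : D.region (p, P.whiteCorner p) = D.region (p, P.whiteCorner p + 2)
  · obtain ⟨eW, heW⟩ := hW.exists_equiv_of_injective fun c c' _ _ =>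
      hW.injective_of_eq _ (P.parity_whiteCorner p) hloop c c'
    have hDW := heW DW.eta
    rw [← goeritz_eq, heta] at hDW
    have hdetW : DW.goeritz.det = (D.weightedGoeritz DB.eta).det := by
      rw [← hDW, det_submatrix_equiv_self]
    have hsigW : matrixSignature DW.goeritz = matrixSignature (D.weightedGoeritz DB.eta) := by
      rw [← hDW, matrixSignature_submatrix]
    have hz : D.incidenceMatrix p = 0 := by
      ext r
      simp [incidenceMatrix, incidence, hloop]
    have hD' : D.goeritz = D.weightedGoeritz DB.eta := by
      rw [hD, hz]; ext; simp
    rw [hdetB] at hdB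
    rw [hdetW, hsigW, hD']
    have := abs_pos.2 hdB
    constructor
    · intro h; omega
    · rintro ⟨-, h⟩; omega
  -- The two regions differ, so at least one of them is bounded; it supplies the extra coordinate.
  · obtain ⟨i, hi, hne, hb⟩ : ∃ i, parity i = P.whiteParity p ∧
        D.region (p, i) ≠ D.region (p, i + 2) ∧ D.region (p, i) ≠ D.region P.unbounded := by
      by_cases h0 : D.region (p, P.whiteCorner p) = D.region P.unbounded
      · refine ⟨P.whiteCorner p + 2, ?_, ?_, ?_⟩
        · rw [parity_add_two, P.parity_whiteCorner]
        · rw [add_two_add_two]; exact Ne.symm hloop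
        · rw [← h0]; exact Ne.symm hloop
      · exact ⟨_, P.parity_whiteCorner p, hloop, h0⟩
    obtain ⟨e, he1, he2⟩ := hW.exists_equiv_of_ne rfl i hi hne hb
    have hDW : DW.goeritz = hW.transferᵀ * D.weightedGoeritz DB.eta * hW.transfer := by
      rw [goeritz_eq, heta, hW.weightedGoeritz_smoothed]
    rw [hdetB] at hdB
    rw [hDW] at hdW ⊢
    rw [hD]
    refine abs_det_rankOne_update_iff_int _ (D.weightedGoeritz_isSymm _) hW.transfer e ?_ _ _ hηp
      ?_ ?_ hdB hdW
    · intro j j'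
      simp only [IsSmoothing.transfer, of_apply, he2]
      exact if_congr (BoundedWhiteRegion.toRegion_injective DW).eq_iff rfl rfl
    · have hpar := (P.parity_whiteCorner p).trans hi.symm
      simp only [incidenceMatrix, of_apply, he1, incidence]
      rcases eq_or_eq_add_two_of_parity_eq _ _ hpar with h1 | h1
      · rw [h1] at hne ⊢
        simp [Ne.symm hne]
      · rw [h1] at hne ⊢
        simp [add_two_add_two] at hne ⊢
        simp [Ne.symm hne]
    -- After the merger both white corners at `p` lie in one region, so row `p` of the new incidence
    -- matrix is zero.
    · have h1 := congrFun hW.incidenceMatrix_mul_transfer p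
      have h2 : DW.incidenceMatrix p = 0 := by
        ext r
        simp [incidenceMatrix, incidence, hW.region_opposite (P.parity_whiteCorner p)]
      rw [← h2, ← h1]
      rfl

end Diagram

/-! ### Components of the Tait graph -/

namespace Diagram
variable {P : PlaneGraph V} {D D' : Diagram P} {p : V} {a : ZMod 2}

/-- The adjacency relation of the Tait graph. -/
def TaitAdj (D : Diagram P) (r s : D.BlackRegion) : Prop :=
  ∃ (v : V) (i : ZMod 4), D.IsCrossing v ∧ P.Black (v, i) ∧
      D.region (v, i) = r.1 ∧ D.region (v, i + 2) = s.1

/-- The component of the Tait graph that contains a black corner. -/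
def taitComponent (D : Diagram P) (c : Dart V) (hc : P.Black c) : Quot D.TaitAdj :=
  Quot.mk _ ⟨D.region c, c, hc, rfl⟩

theorem taitComponent_congr {c c' : Dart V} (hc : P.Black c) (hc' : P.Black c')
    (h : D.region c = D.region c') : D.taitComponent c hc = D.taitComponent c' hc' := by
  unfold taitComponent
  congr 2

theorem taitComponent_opposite {v : V} {i : ZMod 4} (hv : D.IsCrossing v) (hc : P.Black (v, i))
    (hc' : P.Black (v, i + 2)) : D.taitComponent (v, i) hc = D.taitComponent (v, i + 2) hc' :=
  Quot.sound ⟨v, i, hv, hc, rfl, rfl⟩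

/-- Contracting an edge of the Tait graph does not disconnect it. -/
theorem taitComponents_le (h : IsSmoothing p (P.whiteParity p + 1) D D') :
    D.taitComponents ≤ D'.taitComponents := by
  classical
  have hcol : ∀ {x y}, D'.Joined x y → (P.Black x ↔ P.Black y) := fun hxy => by
    rw [P.black_iff_not_white, P.black_iff_not_white, D'.white_iff_of_joined hxy]
  have key : ∀ x y, D'.Joined x y → (if hx : P.Black x then some (D.taitComponent x hx) else none) =
      (if hy : P.Black y then some (D.taitComponent y hy) else none) := by
    intro x y hxy
    have hb := hcol hxy
    by_cases hx : P.Black x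
    · have hy := hb.1 hx
      rw [dif_pos hx, dif_pos hy]
      congr 1
      -- The new identification joins the two ends of the Tait edge `p`, which lie in one component
      -- already.
      rcases (h.joined_iff x y).1 hxy with hj | ⟨i, hi, rfl, rfl⟩
      · exact taitComponent_congr hx hy (Quot.sound hj)
      · exact taitComponent_opposite h.crossing hx hy
    · rw [dif_neg hx, dif_neg (fun hy => hx (hb.2 hy))]
  have hwell : ∀ c c' (hc : P.Black c) (hc' : P.Black c'), D'.region c = D'.region c' →
      D.taitComponent c hc = D.taitComponent c' hc' := fun c c' hc hc' hcc => by
    have := congrArg (Quot.lift _ key) hcc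
    change (if hx : P.Black c then some (D.taitComponent c hx) else none) =
      (if hy : P.Black c' then some (D.taitComponent c' hy) else none) at this
    rw [dif_pos hc, dif_pos hc'] at this
    exact Option.some.inj this
  let f : D'.BlackRegion → Quot D.TaitAdj := fun r => D.taitComponent r.2.choose r.2.choose_spec.1
  have hf : ∀ (r : D'.BlackRegion) c (hc : P.Black c), D'.region c = r.1 →
      f r = D.taitComponent c hc := fun r c hc hcr =>
    hwell _ _ _ _ (r.2.choose_spec.2.trans hcr.symm)
  have hfadj : ∀ r s, D'.TaitAdj r s → f r = f s := by
    rintro r s ⟨v, i, hv, hb, h1, h2⟩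
    have hb' : P.Black (v, i + 2) := by rwa [P.black_iff, parity_add_two, ← P.black_iff]
    rw [hf r _ hb h1, hf s _ hb' h2]
    exact taitComponent_opposite ((h.isCrossing_iff v).1 hv).2 hb hb'
  have : Finite D'.BlackRegion :=
    inferInstanceAs (Finite {r : D'.Region // ∃ c, P.Black c ∧ D'.region c = r})
  refine Nat.card_le_card_of_surjective (Quot.lift f hfadj) ?_
  rintro ⟨r, c, hc, rfl⟩
  exact ⟨Quot.mk _ ⟨D'.region c, c, hc, rfl⟩, hf _ c hc rfl⟩

end Diagram

/-! ### Crossing signs, writhe and the norm of the determinant -/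

namespace OrientedDiagram
variable {P : PlaneGraph V} (L : OrientedDiagram P)

/-- The sign tells whether the corners swept by the upper strand lie between equally directed
half-edges, `η` tells whether they are black, and type II means that the black corners lie between
equally directed half-edges. -/
theorem sign_eq {v : V} (hv : L.IsCrossing v) [Decidable (L.TypeII v)] :
    L.sign v = if L.TypeII v then L.eta v else -L.eta v := by
  classical
  obtain ⟨a, ha⟩ := hv
  have hout := fun i => L.out_crossing v a i ha
  have hII : L.TypeII v ↔ ∃ i, parity i = P.whiteParity v + 1 ∧ L.out (v, i) = L.out (v, i + 1) := by
    simp only [TypeII, P.black_iff]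
    exact and_iff_right ⟨a, ha⟩
  have hsign : L.sign v = if ∃ i, parity i = a ∧ L.out (v, i) = true ∧ L.out (v, i + 1) = true
      then 1 else -1 := by
    simp only [sign, ha]
  rw [hsign, L.eta_of_crossing ha]
  simp only [hII]
  generalize P.whiteParity v = w
  have general : ∀ (o : ZMod 4 → Bool), (∀ i, o (i + 2) = !o i) → ∀ a w : ZMod 2,
    (if ∃ i, parity i = a ∧ o i = true ∧ o (i + 1) = true then (1 : ℤ) else -1) =
      if ∃ i, parity i = w + 1 ∧ o i = o (i + 1) then (if a = w + 1 then 1 else -1)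
      else -(if a = w + 1 then 1 else -1) := by decide
  convert general (fun i => L.out (v, i)) hout a w

open scoped Classical in
theorem writhe_eq : L.writhe = 2 * L.mu - ∑ v, L.eta v := by
  rw [writhe, mu, Finset.sum_filter, Finset.mul_sum, ← Finset.sum_sub_distrib]
  refine Finset.sum_congr rfl fun v _ => ?_
  by_cases hv : L.IsCrossing v
  · rw [L.sign_eq hv]
    split_ifs <;> ring
  · have : ¬ L.TypeII v := fun h => hv h.1
    rw [if_neg this, L.eta_of_not_isCrossing hv]
    cases hf : L.filling v with
    | crossing a => exact absurd ⟨a, hf⟩ hv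
    | smoothing a => simp [sign, hf]

open scoped Classical in
-- The powers of `I` and the type II entries have modulus one; only the zero block can change the
-- absolute value.
theorem norm_det : ‖L.Det‖ = if L.taitComponents ≤ 1 then (|L.goeritz.det| : ℝ) else 0 := by
  have h1 : L.Det = Complex.I ^ (Fintype.card (L.BoundedWhiteRegion ⊕
      ({v : V // L.TypeII v} ⊕ Fin (L.taitComponents - 1)))) * (L.generalizedGoeritz.det : ℂ) := by
    rw [← det_map_intCast, ← det_smul]
    unfold Det
    congr!
  have h2 : L.generalizedGoeritz.det = L.goeritz.det * ((∏ v : {v : V // L.TypeII v}, -L.eta v.1) *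
      (0 : Matrix (Fin (L.taitComponents - 1)) (Fin (L.taitComponents - 1)) ℤ).det) := by
    rw [← det_diagonal, ← det_fromBlocks_zero₂₁ _ 0, ← det_fromBlocks_zero₂₁ _ 0]
    unfold generalizedGoeritz
    congr!
  have h3 : |∏ v : {v : V // L.TypeII v}, -L.eta v.1| = 1 := by
    rw [Finset.abs_prod]
    refine Finset.prod_eq_one fun v _ => ?_
    rcases L.eta_eq_one_or v.1 v.2.1 with h | h <;> simp [h]
  rw [h1, norm_mul, norm_pow, Complex.norm_I, one_pow, one_mul, Complex.norm_intCast, h2]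
  split_ifs with hb
  -- An empty zero block has determinant one; truncated subtraction makes it empty whenever `β ≤ 1`.
  · have : IsEmpty (Fin (L.taitComponents - 1)) := by
      rw [Nat.sub_eq_zero_of_le hb]; infer_instance
    rw [det_isEmpty (A := (0 : Matrix (Fin (L.taitComponents - 1)) _ ℤ)), mul_one, ← Int.cast_abs, abs_mul, h3, mul_one, Int.cast_abs]
  · have : Nonempty (Fin (L.taitComponents - 1)) := ⟨⟨0, by omega⟩⟩
    rw [det_zero]
    simp

end OrientedDiagram

/-! ### Correction terms in a skein triple -/

namespace IsSkeinTriple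
variable {P : PlaneGraph V} {p : V} {L L₀ Linf : OrientedDiagram P}

/-- Each arc of the oriented smoothing cuts off a corner between an incoming and an outgoing
half-edge, so the corners it merges are those between equally directed ones. -/
theorem smoothing_iff_typeII (h : IsSkeinTriple p L L₀ Linf) {a : ZMod 2}
    (ha : L₀.filling p = .smoothing a) : L.TypeII p ↔ a = P.whiteParity p + 1 := by
  obtain ⟨b, hb⟩ := h.crossing
  have hc := fun i => L.out_crossing p b i hb
  have hs := fun i => L₀.out_smoothing p a i ha
  rw [h.orientation] at hs
  constructor
  · rintro ⟨-, i, hi, hio⟩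
    by_contra hne
    rw [P.black_iff] at hi
    have := hs i (fun h0 => hne (h0.symm.trans hi))
    rw [← hio] at this
    simp at this
  · rintro rfl
    obtain ⟨i, hi⟩ := exists_parity_eq (P.whiteParity p + 1)
    refine ⟨h.crossing, i, (P.black_iff p i).2 hi, ?_⟩
    have h1 := hs (i + 1) (by rw [parity_add_one, hi]; exact (zmodTwo_ne_add_one _).symm)
    rw [add_assoc, show (1 + 1 : ZMod 4) = 2 from rfl, hc i] at h1
    simpa using h1

open scoped Classical in
theorem mu_eq (h : IsSkeinTriple p L L₀ Linf) :
    L.mu = L₀.mu + if L.TypeII p then L.eta p else 0 := by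
  obtain ⟨a, ha, -⟩ := h.smoothings
  have hs : Diagram.IsSmoothing p a L.toDiagram L₀.toDiagram := ⟨h.crossing, ha, h.outside_zero⟩
  rw [OrientedDiagram.mu, OrientedDiagram.mu, Finset.sum_filter, Finset.sum_filter,
    ← Finset.add_sum_erase _ _ (Finset.mem_univ p),
    ← Finset.add_sum_erase (f := fun v => if L₀.TypeII v then _ else _) _ (Finset.mem_univ p),
    hs.eta_self, ite_self, zero_add, add_comm]
  congr 1
  refine Finset.sum_congr rfl fun v hv => ?_
  have hv := Finset.ne_of_mem_erase hv
  have : L₀.TypeII v ↔ L.TypeII v := by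
    simp only [OrientedDiagram.TypeII, hs.isCrossing_iff, h.orientation, hv, ne_eq,
      not_false_eq_true, true_and]
  rw [hs.eta_of_ne hv]
  simp only [this]

/-- `η` does not depend on orientations and agrees for both smoothings, so its sum cancels in
`writhe_eq`, however `Linf` is oriented. -/
theorem writhe_sub (h : IsSkeinTriple p L L₀ Linf) :
    L₀.writhe - Linf.writhe = 2 * (L₀.mu - Linf.mu) := by
  obtain ⟨a, ha, ha'⟩ := h.smoothings
  have hs : Diagram.IsSmoothing p a L.toDiagram L₀.toDiagram := ⟨h.crossing, ha, h.outside_zero⟩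
  have hs' : Diagram.IsSmoothing p (a + 1) L.toDiagram Linf.toDiagram :=
    ⟨h.crossing, ha', h.outside_inf⟩
  have : ∑ v, L₀.eta v = ∑ v, Linf.eta v := Finset.sum_congr rfl fun v _ => by
    by_cases hv : v = p
    · subst hv; rw [hs.eta_self, hs'.eta_self]
    · rw [hs.eta_of_ne hv, hs'.eta_of_ne hv]
  rw [L₀.writhe_eq, Linf.writhe_eq, this]
  ring

end IsSkeinTriple

open scoped Classical in
/-- The norms of the determinants of a black and a white smoothing add up precisely when the
first has the same Goeritz signature as the diagram and the second differs from it by `η`. -/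
theorem norm_det_add_iff {P : PlaneGraph V} {p : V} {L LB LW : OrientedDiagram P}
    (hB : Diagram.IsSmoothing p (P.whiteParity p + 1) L.toDiagram LB.toDiagram)
    (hW : Diagram.IsSmoothing p (P.whiteParity p) L.toDiagram LW.toDiagram)
    (hdB : LB.Det ≠ 0) (hdW : LW.Det ≠ 0) :
    ‖L.Det‖ = ‖LB.Det‖ + ‖LW.Det‖ ↔
      matrixSignature L.goeritz = matrixSignature LB.goeritz ∧
      matrixSignature L.goeritz = matrixSignature LW.goeritz + L.eta p := by
  have key : ∀ K : OrientedDiagram P, K.Det ≠ 0 → K.taitComponents ≤ 1 ∧ K.goeritz.det ≠ 0 := by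
    intro K hK
    rw [← norm_ne_zero_iff, K.norm_det] at hK
    split_ifs at hK with h1
    · exact ⟨h1, by simpa using hK⟩
    · exact absurd rfl hK
  obtain ⟨tB, dB⟩ := key LB hdB
  obtain ⟨tW, dW⟩ := key LW hdW
  -- A nonzero determinant bounds the number of components for `LB`, and contracting the edge `p`
  -- passes this bound to `L`.
  have tL := (Diagram.taitComponents_le hB).trans tB
  rw [L.norm_det, LB.norm_det, LW.norm_det, if_pos tL, if_pos tB, if_pos tW,
    ← Diagram.abs_det_goeritz_iff hB hW dB dW]
  norm_cast

end Skein

theorem theorem7p1 {V : Type*} [Fintype V] (P : PlaneGraph V) (p : V)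
    (L L₀ Linf : OrientedDiagram P) (hskein : IsSkeinTriple p L L₀ Linf)
    (h₀ : L₀.Det ≠ 0) (hinf : Linf.Det ≠ 0) :
    (L.sign p = 1 →
      (‖L.Det‖ = ‖L₀.Det‖ + ‖Linf.Det‖ ↔
        L.signature = L₀.signature - 1 ∧
        (L.signature : ℚ) = Linf.signature - 1 / 2 * ((L₀.writhe : ℚ) - Linf.writhe))) ∧
    (L.sign p = -1 →
      (‖L.Det‖ = ‖L₀.Det‖ + ‖Linf.Det‖ ↔
        L.signature = L₀.signature + 1 ∧
        (L.signature : ℚ) = Linf.signature - 1 / 2 * ((L₀.writhe : ℚ) - Linf.writhe))) := by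
  classical
  have hwr : (L.signature : ℚ) = Linf.signature - 1 / 2 * ((L₀.writhe : ℚ) - Linf.writhe) ↔
      L.signature = Linf.signature - (L₀.mu - Linf.mu) := by
    have h1 := congrArg (Int.cast : ℤ → ℚ) hskein.writhe_sub
    push_cast at h1
    rw [h1, ← @Int.cast_inj ℚ]
    push_cast
    ring_nf
  have hmu := hskein.mu_eq
  have hsign := L.sign_eq hskein.crossing
  rw [hwr]
  obtain ⟨a, ha, ha'⟩ := hskein.smoothings
  have hs : Diagram.IsSmoothing p a L.toDiagram L₀.toDiagram :=
    ⟨hskein.crossing, ha, hskein.outside_zero⟩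
  have hs' : Diagram.IsSmoothing p (a + 1) L.toDiagram Linf.toDiagram :=
    ⟨hskein.crossing, ha', hskein.outside_inf⟩
  have htype := hskein.smoothing_iff_typeII ha
  simp only [OrientedDiagram.signature]
  rcases zmodTwo_eq_or a (P.whiteParity p) with rfl | rfl
  -- Here `L₀` merges the white corners, `L.mu = L₀.mu` and the sign of `p` is `-η`.
  · have hI : ¬ L.TypeII p := fun h => zmodTwo_ne_add_one _ (htype.1 h)
    rw [if_neg hI] at hmu hsign
    rw [add_comm ‖L₀.Det‖, norm_det_add_iff hs' hs hinf h₀]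
    constructor <;> intro hp <;> rw [hp] at hsign <;> omega
  -- Here `L₀` merges the black corners, `L.mu = L₀.mu + η` and the sign of `p` is `η`.
  · have hII : L.TypeII p := htype.2 rfl
    rw [if_pos hII] at hmu hsign
    have h2 : P.whiteParity p + 1 + 1 = P.whiteParity p := by
      generalize P.whiteParity p = x
      revert x; decide
    rw [h2] at hs'
    rw [norm_det_add_iff hs hs' h₀ hinf]
    constructor <;> intro hp <;> rw [hp] at hsign <;> omega
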